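/- **Setting.** Let $d\ge 2$ and let $\Omega\subset\mathbb R^d$ be a bounded open set with $\mathcal C^1$ boundary, with outward unit normal $n(x)$ and surface measure $\pi$ on $\partial\Omega$. Let $m$ be a $\sigma$-finite nonnegative Borel measure on $\mathbb R^d$, invariant under all orthogonal transformations, with support $V$, such that $0\in V$, $m(\{0\})=0$ and $m(V\cap B(0,r))>0$ for every $r>0$. Put $$\Gamma_\pm=\{(x,v)\in\partial\Omega\times V:\ \pm\, v\cdot n(x)>0\},\qquad d\mu_\pm=|v\cdot n(x)|\,\pi(dx)\otimes m(dv)\ \text{ on }\Gamma_\pm ,\qquad L^1_\pm=L^1(\Gamma_\pm,d\mu_\pm;\mathbb C).$$ For $(x,v)\in\Gamma_+$ let $\tau_-(x,v)=\inf\{s>0:\ x-sv\notin\Omega\}$, and for $\lambda\in\mathbb C$ with $\operatorname{Re}\lambda\ge0$ let $$\mathsf M_\lambda:L^1_-\to L^1_+,\qquad \mathsf M_\lambda u(x,v)=e^{-\lambda\tau_-(x,v)}\,u\big(x-\tau_-(x,v)v,\,v\big).$$ Let $\mathsf H:L^1_+\to L^1_-$ be a bounded stochastic operator (that is, $\int_{\Gamma_-}\mathsf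 H\psi\,d\mu_-=\int_{\Gamma_+}\psi\,d\mu_+$ for all $\psi\in L^1_+$) of the form $$\mathsf H\psi(x,v)=\int_{v'\cdot n(x)>0}k(x,v,v')\,\psi(x,v')\,|v'\cdot n(x)|\,m(dv'),\qquad (x,v)\in\Gamma_-,$$ with a measurable kernel $k\ge0$ such that $\int_{v\cdot n(x)<0}k(x,v,v')|v\cdot n(x)|\,m(dv)=1$ for almost every $(x,v')\in\Gamma_+$. Assume that 1. for some integer $n\ge0$, $\mathsf H$ maps $L^1_+$ boundedly into $L^1(\Gamma_-,\max(1,|v|^{-(n+1)})\,d\mu_-)$; 2. $\mathsf H\mathsf M_0\mathsf H:L^1_+\to L^1_-$ is weakly compact; 3. $\mathsf M_0\mathsf H$ is irreducible on $L^1_+$ (if $A\subset\Gamma_+$ is measurable and $\mathsf M_0\mathsf H$ leaves invariant the space of those $\psi\in L^1_+$ that vanish a.e. outside $A$, then $\mu_+(A)=0$ or $\mu_+(\Gamma_+\setminus A)=0$); 4. there are $p\in\mathbb N$ and $C>0$ such that $\int_{\mathbb R}\|(\mathsf M_{\varepsilon+i\eta}\mathsf H)^p\|_{\mathscr B(L^1_+)}\,d\eta\le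 C$ for all $\varepsilon\ge0$. **Proposition.** For every $\lambda\in\mathbb C\setminus\{0\}$ with $\operatorname{Re}\lambda\ge0$, $\mathsf M_\lambda$ is a well-defined bounded operator from $L^1_-$ to $L^1_+$, and the spectral radius of $\mathsf M_\lambda\mathsf H$ on $L^1_+$ satisfies $$r_\sigma(\mathsf M_\lambda\mathsf H)<1 .$$ -/

import Mathlib

open MeasureTheory Filter Topology
open scoped ENNReal NNReal

noncomputable section

namespace Kinetic

/-- Position and velocity space `ℝᵈ` with its Euclidean norm. -/
abbrev Sp (d : ℕ) : Type := EuclideanSpace ℝ (Fin d)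

/-! ### Domains with `C¹` boundary -/

/-- `ρ` is a `C¹` defining function of `Ω` near `x`: its gradient does not vanish near `x`, and
near `x` the set `Ω` is `{ρ < 0}` (so `∂Ω` is `{ρ = 0}` and `Ω` lies on one side of it). -/
def IsDefiningFunctionAt {d : ℕ} (Ω : Set (Sp d)) (x : Sp d) (ρ : Sp d → ℝ) : Prop :=
  ∃ U : Set (Sp d), IsOpen U ∧ x ∈ U ∧ ContDiffOn ℝ 1 ρ U ∧
    (∀ y ∈ U, gradient ρ y ≠ 0) ∧ ∀ y ∈ U, y ∈ Ω ↔ ρ y < 0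

def HasC1Boundary {d : ℕ} (Ω : Set (Sp d)) : Prop :=
  ∀ x ∈ frontier Ω, ∃ ρ : Sp d → ℝ, IsDefiningFunctionAt Ω x ρ

open Classical in
/-- The outward unit normal `∇ρ(x) / |∇ρ(x)|` at a point of the boundary, where `ρ` is any `C¹`
defining function (the result does not depend on it); zero away from the boundary. -/
def outerNormal {d : ℕ} (Ω : Set (Sp d)) (x : Sp d) : Sp d :=
  if h : x ∈ frontier Ω ∧ ∃ ρ : Sp d → ℝ, IsDefiningFunctionAt Ω x ρ then
    ‖gradient h.2.choose x‖⁻¹ • gradient h.2.choose x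
  else 0

/-- Surface measure on `∂Ω`: the `(d-1)`-dimensional Hausdorff measure, normalized so that it is
Lebesgue measure on hyperplanes. -/
def surfaceMeasure {d : ℕ} (Ω : Set (Sp d)) : Measure (Sp d) :=
  (Measure.euclideanHausdorffMeasure (d - 1) : Measure (Sp d)).restrict (frontier Ω)

/-! ### Phase space -/

/-- The conditions on the phase space `Ω × V`, where `V` is the support of `m`. -/
structure IsPhaseSpace {d : ℕ} (Ω : Set (Sp d)) (m : Measure (Sp d)) : Prop where
  isOpen : IsOpen Ω
  isBounded : Bornology.IsBounded Ω
  c1Boundary : HasC1Boundary Ω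
  orthogonallyInvariant : ∀ g : Sp d ≃ₗᵢ[ℝ] Sp d, m.map g = m
  zero_mem : (0 : Sp d) ∈ m.support
  zero_null : m {0} = 0
  small_velocities : ∀ r : ℝ, 0 < r → 0 < m (m.support ∩ Metric.ball 0 r)

/-- Outgoing part `Γ₊` of the boundary of phase space. -/
def outSet {d : ℕ} (Ω : Set (Sp d)) (m : Measure (Sp d)) : Set (Sp d × Sp d) :=
  {p | p.1 ∈ frontier Ω ∧ p.2 ∈ m.support ∧ 0 < inner ℝ p.2 (outerNormal Ω p.1)}

/-- Incoming part `Γ₋` of the boundary of phase space. -/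
def inSet {d : ℕ} (Ω : Set (Sp d)) (m : Measure (Sp d)) : Set (Sp d × Sp d) :=
  {p | p.1 ∈ frontier Ω ∧ p.2 ∈ m.support ∧ inner ℝ p.2 (outerNormal Ω p.1) < 0}

/-- The measure `|v · n(x)| π(dx) ⊗ m(dv)`. -/
def fluxMeasure {d : ℕ} (Ω : Set (Sp d)) (m : Measure (Sp d)) : Measure (Sp d × Sp d) :=
  ((surfaceMeasure Ω).prod m).withDensity
    fun p => ENNReal.ofReal |inner ℝ p.2 (outerNormal Ω p.1)|

def outMeasure {d : ℕ} (Ω : Set (Sp d)) (m : Measure (Sp d)) : Measure (Sp d × Sp d) :=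
  (fluxMeasure Ω m).restrict (outSet Ω m)

def inMeasure {d : ℕ} (Ω : Set (Sp d)) (m : Measure (Sp d)) : Measure (Sp d × Sp d) :=
  (fluxMeasure Ω m).restrict (inSet Ω m)

/-- The complex space `L¹₊ = L¹(Γ₊, dμ₊)`. -/
abbrev L1out {d : ℕ} (Ω : Set (Sp d)) (m : Measure (Sp d)) : Type := Lp ℂ 1 (outMeasure Ω m)

/-- The complex space `L¹₋ = L¹(Γ₋, dμ₋)`. -/
abbrev L1in {d : ℕ} (Ω : Set (Sp d)) (m : Measure (Sp d)) : Type := Lp ℂ 1 (inMeasure Ω m)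

/-! ### The transfer operators `M_λ` -/

/-- Backward exit time `τ₋(x, v)`. -/
def exitTime {d : ℕ} (Ω : Set (Sp d)) (p : Sp d × Sp d) : ℝ :=
  sInf {s : ℝ | 0 < s ∧ p.1 - s • p.2 ∉ Ω}

/-- `T` is the bounded operator `u ↦ e^{-λ τ₋(x,v)} u(x - τ₋(x,v) v, v)` from `L¹₋` to `L¹₊`. -/
def IsTransferOp {d : ℕ} (Ω : Set (Sp d)) (m : Measure (Sp d)) (lam : ℂ)
    (T : L1in Ω m →L[ℂ] L1out Ω m) : Prop :=
  ∀ u : L1in Ω m, (T u : Sp d × Sp d → ℂ) =ᵐ[outMeasure Ω m] fun p =>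
    Complex.exp (-lam * (exitTime Ω p : ℂ)) *
      (u : Sp d × Sp d → ℂ) (p.1 - exitTime Ω p • p.2, p.2)

open Classical in
/-- The operator `M_λ : L¹₋ → L¹₊`. There is at most one operator with the defining property
`IsTransferOp`; the theorem asserts, too, that it exists, so that the value `0` is never used. -/
def transferOp {d : ℕ} (Ω : Set (Sp d)) (m : Measure (Sp d)) (lam : ℂ) :
    L1in Ω m →L[ℂ] L1out Ω m :=
  if h : ∃ T : L1in Ω m →L[ℂ] L1out Ω m, IsTransferOp Ω m lam T then h.choose else 0

/-- `M_λ H` as an operator on `L¹₊`. -/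
def MH {d : ℕ} (Ω : Set (Sp d)) (m : Measure (Sp d)) (H : L1out Ω m →L[ℂ] L1in Ω m) (lam : ℂ) :
    L1out Ω m →L[ℂ] L1out Ω m :=
  (transferOp Ω m lam).comp H

/-! ### Diffuse boundary operators -/

/-- `H` is the stochastic diffuse boundary operator with kernel `k`. -/
structure IsStochasticDiffuse {d : ℕ} (Ω : Set (Sp d)) (m : Measure (Sp d))
    (k : Sp d → Sp d → Sp d → ℝ) (H : L1out Ω m →L[ℂ] L1in Ω m) : Prop where
  measurable : Measurable fun q : Sp d × Sp d × Sp d => k q.1 q.2.1 q.2.2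
  nonneg : ∀ x v v', (x, v) ∈ inSet Ω m → (x, v') ∈ outSet Ω m → 0 ≤ k x v v'
  /-- `∫_{v · n(x) < 0} k(x, v, v') |v · n(x)| m(dv) = 1` for almost every `(x, v') ∈ Γ₊`. -/
  normalised : ∀ᵐ p ∂(outMeasure Ω m),
    ∫⁻ v in {v | (p.1, v) ∈ inSet Ω m},
      ENNReal.ofReal (k p.1 v p.2 * |inner ℝ v (outerNormal Ω p.1)|) ∂m = 1
  /-- `H ψ (x, v) = ∫_{v' · n(x) > 0} k(x, v, v') ψ(x, v') |v' · n(x)| m(dv')`. -/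
  kernel_form : ∀ ψ : L1out Ω m, (H ψ : Sp d × Sp d → ℂ) =ᵐ[inMeasure Ω m] fun p =>
    ∫ v' in {v' | (p.1, v') ∈ outSet Ω m},
      ((k p.1 p.2 v' * |inner ℝ v' (outerNormal Ω p.1)| : ℝ) : ℂ) *
        (ψ : Sp d × Sp d → ℂ) (p.1, v') ∂m
  mass_preserving : ∀ ψ : L1out Ω m,
    ∫ p, (H ψ : Sp d × Sp d → ℂ) p ∂(inMeasure Ω m) =
      ∫ p, (ψ : Sp d × Sp d → ℂ) p ∂(outMeasure Ω m)

/-- `H` maps `L¹₊` boundedly into the weighted space `L¹(Γ₋, max(1, |v|⁻ˢ) dμ₋)`. -/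
def GainsIntegrability {d : ℕ} (Ω : Set (Sp d)) (m : Measure (Sp d))
    (H : L1out Ω m →L[ℂ] L1in Ω m) (s : ℕ) : Prop :=
  ∃ C : ℝ≥0, ∀ ψ : L1out Ω m,
    ∫⁻ p, ENNReal.ofReal (max 1 (‖p.2‖⁻¹ ^ s)) * ‖(H ψ : Sp d × Sp d → ℂ) p‖ₑ ∂(inMeasure Ω m) ≤
      C * ‖ψ‖ₑ

/-- Weak compactness: the image of the unit ball is relatively compact in the weak topology. -/
def IsWeaklyCompact {E F : Type*} [NormedAddCommGroup E] [NormedSpace ℂ E]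
    [NormedAddCommGroup F] [NormedSpace ℂ F] (T : E →L[ℂ] F) : Prop :=
  IsCompact (closure (toWeakSpace ℂ F '' (T '' Metric.closedBall 0 1)))

/-- Irreducibility on `L¹(μ)`, `μ` σ-finite: no nontrivial band `{ψ : ψ = 0 a.e. off A}` (these are
the closed ideals of `L¹(μ)`) is invariant under `T`. -/
def IsIrreducibleOp {X : Type*} [MeasurableSpace X] {μ : Measure X}
    (T : Lp ℂ 1 μ →L[ℂ] Lp ℂ 1 μ) : Prop :=
  ∀ A : Set X, MeasurableSet A →
    (∀ ψ : Lp ℂ 1 μ, (∀ᵐ p ∂μ, p ∉ A → (ψ : X → ℂ) p = 0) →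
      ∀ᵐ p ∂μ, p ∉ A → (T ψ : X → ℂ) p = 0) →
    μ A = 0 ∨ μ Aᶜ = 0

/-- The standing conditions on the boundary operator `H` with kernel `k`. -/
structure IsAdmissibleBoundaryOp {d : ℕ} (Ω : Set (Sp d)) (m : Measure (Sp d))
    (k : Sp d → Sp d → Sp d → ℝ) (H : L1out Ω m →L[ℂ] L1in Ω m) : Prop where
  diffuse : IsStochasticDiffuse Ω m k H
  gain : ∃ n : ℕ, GainsIntegrability Ω m H (n + 1)
  weaklyCompact : IsWeaklyCompact (H.comp (MH Ω m H 0))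
  irreducible : IsIrreducibleOp (MH Ω m H 0)
  power_integrable : ∃ (p : ℕ) (C : ℝ≥0), ∀ ε : ℝ, 0 ≤ ε →
    ∫⁻ η : ℝ, ‖MH Ω m H ((ε : ℂ) + (η : ℂ) * Complex.I) ^ p‖ₑ ≤ C

end Kinetic

end

/-! For `Re λ ≥ 0` the operator `M_λ` exists and is a contraction. For a fixed velocity `v`, the
backward exit map is injective from the outgoing boundary into the part where `v · n ≤ 0`, and it
moves points along `v`, so it preserves their projection along `v`. The flux `|v · n| dπ` is, up to
the factor `|v|`, the area of this projection on small transversal pieces. Arrival points where `v`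
is tangential project to a null set. Hence the exit map does not increase flux
(`map_exitPoint_outMeasure_le`). Since `H` is positive and preserves mass, `‖M_λ H‖ ≤ 1`.

Suppose the spectral radius is not below one. Then the spectrum contains some `z` with `|z| = 1`,
and for a contraction such a `z` is an approximate eigenvalue (`exists_approximate_eigenvector`).
Let `f` be a corresponding unit vector. Almost no mass is lost in `|M_λ H f| ≤ M_0 H |f|`, and this
near-equality is rigid.

If `Re λ > 0`, the damping `e^{-Re λ τ₋}` costs almost nothing, so `τ₋` is nearly zero on most of
the mass, and `|f|` is almost fixed by every `M_{iζ} H` (`norm_MH_imaginary_sub_le`).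

If `λ = iη` with `η ≠ 0`, the phases of `f` are almost aligned inside the kernel integral. They stay
aligned when raised to the power `j`, so `|f| (f/|f|)^j` is an approximate eigenvector of `M_{ijη}
H` for `z^j` (`norm_MH_phaseLp_sub_le`). The quantitative form is `1 - cos jθ ≤ j² (1 - cos θ)`,
which can be integrated against a nonnegative kernel.

An approximate eigenvalue of modulus one forces `‖(M_{iζ} H)^p‖ ≥ 1`: for all `ζ` in the first case,
for `ζ = jη` in the second. In the second case the gain of integrability makes `ζ ↦ M_{iζ} H`
Lipschitz, so the norm is at least `1/2` on intervals of fixed length around all `jη`. Either way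
the integral of the norm over the imaginary axis diverges, against the integrability condition at `ε
= 0`. -/

noncomputable section

namespace Kinetic

section

/-! ### Partial projections and their volume factor on hyperplanes -/

section Squeeze

variable {E : Type*} [NormedAddCommGroup E] [InnerProductSpace ℝ E]

/-- The linear map that multiplies the component along the unit vector `e` by `δ` and is the
identity on the orthogonal complement; `squeeze e 0` is the orthogonal projection along `e`. -/
def squeeze (e : E) (δ : ℝ) : E →L[ℝ] E :=
  ContinuousLinearMap.id ℝ E - (1 - δ) • (innerSL ℝ e).smulRight e

theorem squeeze_apply (e : E) (δ : ℝ) (x : E) :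
    squeeze e δ x = x - ((1 - δ) * inner ℝ e x) • e := by
  simp [squeeze, smul_smul]

theorem inner_squeeze_squeeze {e : E} (he : ‖e‖ = 1) (δ : ℝ) (x y : E) :
    inner ℝ (squeeze e δ x) (squeeze e δ y) =
      inner ℝ x y - (1 - δ ^ 2) * (inner ℝ e x * inner ℝ e y) := by
  have h1 : inner ℝ e e = (1 : ℝ) := by rw [real_inner_self_eq_norm_sq, he]; norm_num
  simp only [squeeze_apply, inner_sub_left, inner_sub_right, inner_smul_left, inner_smul_right,
    h1, real_inner_comm e x, RCLike.conj_to_real]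
  ring

theorem norm_squeeze_sq {e : E} (he : ‖e‖ = 1) (δ : ℝ) (x : E) :
    ‖squeeze e δ x‖ ^ 2 = ‖x‖ ^ 2 - (1 - δ ^ 2) * inner ℝ e x ^ 2 := by
  rw [← real_inner_self_eq_norm_sq, inner_squeeze_squeeze he, real_inner_self_eq_norm_sq]
  ring

theorem norm_squeeze_le {e : E} (he : ‖e‖ = 1) {δ : ℝ} (h0 : 0 ≤ δ) (h1 : δ ≤ 1) (x : E) :
    ‖squeeze e δ x‖ ≤ ‖x‖ := by
  refine le_of_sq_le_sq ?_ (norm_nonneg _)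
  rw [norm_squeeze_sq he]
  have : 0 ≤ (1 - δ ^ 2) * inner ℝ e x ^ 2 := mul_nonneg (by nlinarith) (sq_nonneg _)
  linarith

theorem squeeze_zero_squeeze {e : E} (he : ‖e‖ = 1) (δ : ℝ) (x : E) :
    squeeze e 0 (squeeze e δ x) = squeeze e 0 x := by
  have h1 : inner ℝ e e = (1 : ℝ) := by rw [real_inner_self_eq_norm_sq, he]; norm_num
  simp only [squeeze_apply, inner_sub_right, inner_smul_right, h1]
  module

theorem squeeze_zero_add_smul {e : E} (he : ‖e‖ = 1) (x : E) (s : ℝ) :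
    squeeze e 0 (x + s • e) = squeeze e 0 x := by
  have h1 : inner ℝ e e = (1 : ℝ) := by rw [real_inner_self_eq_norm_sq, he]; norm_num
  simp only [squeeze_apply, inner_add_right, inner_smul_right, h1]
  module

/-- The volume factor of `squeeze e δ` on the hyperplane orthogonal to a unit vector `n` with
`inner ℝ e n = c`. -/
def squeezeFactor (c δ : ℝ) : ℝ := Real.sqrt (1 - (1 - δ ^ 2) * (1 - c ^ 2))

theorem squeezeFactor_zero (c : ℝ) : squeezeFactor c 0 = |c| := by
  rw [squeezeFactor, ← Real.sqrt_sq_eq_abs]; congr 1; ring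

theorem squeezeFactor_zero_left {δ : ℝ} (h : 0 ≤ δ) : squeezeFactor 0 δ = δ := by
  rw [squeezeFactor, show 1 - (1 - δ ^ 2) * (1 - (0 : ℝ) ^ 2) = δ ^ 2 by ring, Real.sqrt_sq h]

/-- On the hyperplane orthogonal to `n`, only the tangential part `e - (e · n) n` of `e` matters.
Its squared length is `1 - (e · n)²`, and Cauchy–Schwarz bounds the length lost. -/
theorem squeezeFactor_mul_norm_le {e n : E} (he : ‖e‖ = 1) (hn : ‖n‖ = 1) {δ : ℝ}
    (h0 : 0 ≤ δ) (h1 : δ ≤ 1) {w : E} (hw : inner ℝ n w = 0) :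
    squeezeFactor (inner ℝ e n) δ * ‖w‖ ≤ ‖squeeze e δ w‖ := by
  have hc : inner ℝ e n ^ 2 ≤ (1 : ℝ) := by
    have := abs_real_inner_le_norm e n
    rw [he, hn, mul_one] at this
    exact (sq_le_one_iff_abs_le_one _).2 this
  have key : inner ℝ e w ^ 2 ≤ (1 - inner ℝ e n ^ 2) * ‖w‖ ^ 2 := by
    have h2 : inner ℝ e w = inner ℝ (e - (inner ℝ e n : ℝ) • n) w := by
      simp [inner_sub_left, inner_smul_left, hw]
    have h3 : ‖e - (inner ℝ e n : ℝ) • n‖ ^ 2 = 1 - inner ℝ e n ^ 2 := by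
      rw [norm_sub_sq_real, inner_smul_right, norm_smul, he, hn, Real.norm_eq_abs, mul_one, sq_abs]
      ring
    have h4 := abs_real_inner_le_norm (e - (inner ℝ e n : ℝ) • n) w
    rw [h2, ← h3, ← mul_pow, ← sq_abs (inner ℝ _ w)]
    gcongr
  refine le_of_sq_le_sq ?_ (norm_nonneg _)
  rw [norm_squeeze_sq he, mul_pow, squeezeFactor, Real.sq_sqrt]
  · have : 0 ≤ 1 - δ ^ 2 := by nlinarith
    nlinarith [mul_le_mul_of_nonneg_left key this]
  · have : 0 ≤ 1 - δ ^ 2 := by nlinarith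
    nlinarith [sq_nonneg (inner ℝ e n), sq_nonneg δ, mul_nonneg this (sq_nonneg (inner ℝ e n))]

variable [FiniteDimensional ℝ E]

/-- With `q` the tangential part of `e`, the Gram operator of the restricted map is the rank-one
perturbation `1 - (1 - δ²) ⟨q, ·⟩ q`. It is a transvection, with determinant `1 - (1 - δ²) |q|²`. -/
theorem normDet_squeeze {e n : E} (he : ‖e‖ = 1) (hn : ‖n‖ = 1) (δ : ℝ) :
    ((squeeze e δ : E →ₗ[ℝ] E) ∘ₗ (Submodule.span ℝ {n})ᗮ.subtype).normDet =
      squeezeFactor (inner ℝ e n) δ := by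
  set W : Submodule ℝ E := (Submodule.span ℝ {n})ᗮ with hW
  set f : W →ₗ[ℝ] E := (squeeze e δ : E →ₗ[ℝ] E) ∘ₗ W.subtype with hf
  have hnn : inner ℝ n n = (1 : ℝ) := by rw [real_inner_self_eq_norm_sq, hn]; norm_num
  have hee : inner ℝ e e = (1 : ℝ) := by rw [real_inner_self_eq_norm_sq, he]; norm_num
  have hq : e - (inner ℝ e n : ℝ) • n ∈ W := by
    rw [hW, Submodule.mem_orthogonal_singleton_iff_inner_right, inner_sub_right, inner_smul_right,
      hnn, real_inner_comm e n]
    ring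
  let q : W := ⟨e - (inner ℝ e n : ℝ) • n, hq⟩
  have hin : ∀ w : W, inner ℝ e (w : E) = inner ℝ q w := by
    intro w
    have : inner ℝ n (w : E) = 0 := (Submodule.mem_orthogonal_singleton_iff_inner_right).1 w.2
    rw [Submodule.coe_inner]
    simp [q, inner_sub_left, inner_smul_left, this]
  have hadj : LinearMap.adjoint f ∘ₗ f =
      LinearMap.transvection ((-(1 - δ ^ 2)) • (innerSL ℝ q : W →ₗ[ℝ] ℝ)) q := by
    ext1 w
    refine ext_inner_right ℝ fun z => ?_
    rw [LinearMap.comp_apply, LinearMap.adjoint_inner_left]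
    simp only [hf, LinearMap.comp_apply, ContinuousLinearMap.coe_coe, Submodule.subtype_apply,
      inner_squeeze_squeeze he, hin, LinearMap.transvection.apply, inner_add_left, inner_smul_left]
    simp [Submodule.coe_inner]
    ring
  have hsq : f.normDet ^ 2 = 1 - (1 - δ ^ 2) * (1 - inner ℝ e n ^ 2) := by
    have := f.normDet_sq
    rw [hadj, LinearMap.transvection.det] at this
    have h5 : f.normDet ^ 2 = 1 + ((-(1 - δ ^ 2)) • (innerSL ℝ q : W →ₗ[ℝ] ℝ)) q := by
      exact_mod_cast this
    rw [h5]
    have : inner ℝ q q = 1 - (inner ℝ e n : ℝ) ^ 2 := by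
      rw [← hin]
      simp [q, inner_sub_right, inner_smul_right, he]
      ring
    simp only [LinearMap.smul_apply, ContinuousLinearMap.coe_coe, innerSL_apply_apply, this]
    simp
    ring
  rw [squeezeFactor, ← hsq, Real.sqrt_sq f.normDet_nonneg]

theorem finrank_orthogonal_unit {n : E} (hn : ‖n‖ = 1) :
    Module.finrank ℝ (Submodule.span ℝ {n})ᗮ = Module.finrank ℝ E - 1 := by
  have h := (Submodule.span ℝ {n}).finrank_add_finrank_orthogonal
  rw [finrank_span_singleton (by intro h; simp [h] at hn)] at h
  omega

variable [MeasurableSpace E] [BorelSpace E]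

theorem euclideanHausdorffMeasure_squeeze_image {e n : E} (he : ‖e‖ = 1) (hn : ‖n‖ = 1) (δ : ℝ)
    {B : Set E} (hB : ∀ w ∈ B, inner ℝ n w = 0) :
    (Measure.euclideanHausdorffMeasure (Module.finrank ℝ E - 1) : Measure E) (squeeze e δ '' B) =
      ENNReal.ofReal (squeezeFactor (inner ℝ e n) δ) *
        (Measure.euclideanHausdorffMeasure (Module.finrank ℝ E - 1) : Measure E) B := by
  set W : Submodule ℝ E := (Submodule.span ℝ {n})ᗮ with hW
  have hBW : B = W.subtype '' (Subtype.val ⁻¹' B : Set W) := by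
    ext x
    constructor
    · intro hx
      exact ⟨⟨x, Submodule.mem_orthogonal_singleton_iff_inner_right.2 (hB x hx)⟩, hx, rfl⟩
    · rintro ⟨y, hy, rfl⟩
      exact hy
  have h1 := ((squeeze e δ : E →ₗ[ℝ] E) ∘ₗ W.subtype).euclideanHausdorffMeasure_image
    (Subtype.val ⁻¹' B)
  have h2 : (Measure.euclideanHausdorffMeasure (Module.finrank ℝ W) : Measure E)
      (W.subtype '' (Subtype.val ⁻¹' B : Set W)) = Measure.euclideanHausdorffMeasure
        (Module.finrank ℝ W) (Subtype.val ⁻¹' B : Set W) :=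
    (W.subtypeₗᵢ.isometry).euclideanHausdorffMeasure_image _
  rw [normDet_squeeze he hn, ← h2, ← hBW, finrank_orthogonal_unit hn, LinearMap.coe_comp,
    Set.image_comp, ← hBW] at h1
  exact h1

end Squeeze

/-! ### Hausdorff measure under comparison of distances -/

section Comparison

variable {X Y Z : Type*} [MetricSpace X] [MeasurableSpace X] [BorelSpace X]
  [MetricSpace Y] [MeasurableSpace Y] [BorelSpace Y]

theorem _root_.LipschitzOnWith.euclideanHausdorffMeasure_image_le {f : X → Y} {K : ℝ≥0}
    {A : Set X} (h : LipschitzOnWith K f A) (k : ℕ) :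
    (Measure.euclideanHausdorffMeasure k : Measure Y) (f '' A) ≤
      K ^ k * (Measure.euclideanHausdorffMeasure k : Measure X) A := by
  have := h.hausdorffMeasure_image_le (d := k) (by positivity)
  simp only [Measure.euclideanHausdorffMeasure_def, Measure.smul_apply, ENNReal.smul_def,
    smul_eq_mul]
  rw [ENNReal.rpow_natCast] at this
  calc _ ≤ _ * (K ^ k * μH[k] A) := by gcongr
    _ = _ := by ring

/-- The hypothesis makes `f` factor on `A` through `g` by a Lipschitz map: any right inverse of `g`
on `g '' A` gives it, since points with equal `g` have equal `f`. -/
theorem euclideanHausdorffMeasure_image_le_of_dist_le {f : Z → Y} {g : Z → X} {A : Set Z} {s : ℝ}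
    (hs : 0 ≤ s) (h : ∀ x ∈ A, ∀ y ∈ A, dist (f x) (f y) ≤ s * dist (g x) (g y)) (k : ℕ) :
    (Measure.euclideanHausdorffMeasure k : Measure Y) (f '' A) ≤
      ENNReal.ofReal (s ^ k) * (Measure.euclideanHausdorffMeasure k : Measure X) (g '' A) := by
  classical
  rcases A.eq_empty_or_nonempty with rfl | hne
  · simp
  have : Nonempty Z := ⟨hne.some⟩
  let i : X → Z := Function.invFunOn g A
  have hi : ∀ y ∈ g '' A, i y ∈ A ∧ g (i y) = y := fun y hy =>
    ⟨Function.invFunOn_mem hy, Function.invFunOn_eq hy⟩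
  have hL : LipschitzOnWith s.toNNReal (f ∘ i) (g '' A) := by
    refine LipschitzOnWith.of_dist_le_mul fun x hx y hy => ?_
    have := h _ (hi x hx).1 _ (hi y hy).1
    rw [(hi x hx).2, (hi y hy).2] at this
    rwa [Real.coe_toNNReal _ hs]
  have himg : (f ∘ i) '' (g '' A) = f '' A := by
    rw [Set.image_image]
    refine Set.image_congr fun x hx => ?_
    have h1 := hi (g x) ⟨x, hx, rfl⟩
    have h2 := h _ h1.1 x hx
    rw [h1.2, dist_self, mul_zero] at h2
    exact dist_le_zero.1 h2
  have := hL.euclideanHausdorffMeasure_image_le k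
  rw [himg] at this
  rwa [ENNReal.ofReal_pow hs]

end Comparison

/-! ### Almost flat pieces of hypersurfaces -/

section Flat

variable {E : Type*} [NormedAddCommGroup E] [InnerProductSpace ℝ E] [FiniteDimensional ℝ E]
  [MeasurableSpace E] [BorelSpace E]

theorem exists_one_lt_pow_le {t : ℝ} (ht : 1 < t) (k : ℕ) : ∃ s : ℝ, 1 < s ∧ s ^ k ≤ t := by
  have h1 : Tendsto (fun s : ℝ => s ^ k) (𝓝[>] 1) (𝓝 1) :=
    ((continuous_pow k).tendsto' 1 1 (one_pow k)).mono_left nhdsWithin_le_nhds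
  obtain ⟨s, hs1, hs2⟩ := ((h1.eventually_le_const ht).and self_mem_nhdsWithin).exists
  exact ⟨s, hs2, hs1⟩

/-- On an almost flat piece of a hypersurface with normal direction close to `n`, the map
`squeeze e δ` changes `(dim E - 1)`-dimensional measure almost as it does on the hyperplane
orthogonal to `n`. -/
theorem exists_flatness {e n : E} (he : ‖e‖ = 1) (hn : ‖n‖ = 1) {δ : ℝ} (h0 : 0 ≤ δ) (h1 : δ ≤ 1)
    (hD : 0 < squeezeFactor (inner ℝ e n) δ) {t : ℝ} (ht : 1 < t) :
    ∃ ε : ℝ, 0 < ε ∧ ∀ A : Set E,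
      (∀ x ∈ A, ∀ y ∈ A, |inner ℝ n (x - y)| ≤ ε * ‖x - y‖) →
      Set.InjOn (squeeze e δ) A ∧
      (Measure.euclideanHausdorffMeasure (Module.finrank ℝ E - 1) : Measure E)
          (squeeze e δ '' A) ≤
        ENNReal.ofReal t * (ENNReal.ofReal (squeezeFactor (inner ℝ e n) δ) *
          (Measure.euclideanHausdorffMeasure (Module.finrank ℝ E - 1) : Measure E) A) ∧
      ENNReal.ofReal (squeezeFactor (inner ℝ e n) δ) *
          (Measure.euclideanHausdorffMeasure (Module.finrank ℝ E - 1) : Measure E) A ≤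
        ENNReal.ofReal t * (Measure.euclideanHausdorffMeasure (Module.finrank ℝ E - 1) : Measure E)
          (squeeze e δ '' A) := by
  set k := Module.finrank ℝ E - 1
  set D := squeezeFactor (inner ℝ e n) δ with hDdef
  set σ := (Measure.euclideanHausdorffMeasure k : Measure E)
  -- The lower estimate uses two comparisons of `k`-dimensional measure, each costing `s ^ k`.
  obtain ⟨s, hs, hst⟩ := exists_one_lt_pow_le ht (2 * k)
  have hs0 : 0 < s := by linarith
  -- Let `Q = squeeze n 0`. The first bound gives `‖h‖ ≤ s ‖Q h‖` for differences `h` of points of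
  -- `A`. The second makes the error `ε ‖h‖` of replacing `h` by `Q h` small relative to `D ‖Q h‖`,
  -- a lower bound for the squeezed length of `Q h`.
  refine ⟨min ((s - 1) / s) (D * (s - 1) / s ^ 2), ?_, fun A hA => ?_⟩
  · refine lt_min (div_pos (by linarith) hs0) (div_pos (mul_pos hD (by linarith)) (by positivity))
  set ε := min ((s - 1) / s) (D * (s - 1) / s ^ 2)
  have hε0 : 0 ≤ ε := le_min (div_nonneg (by linarith) hs0.le)
    (div_nonneg (mul_nonneg hD.le (by linarith)) (by positivity))
  have hε1 : ε * s ≤ s - 1 := by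
    have := min_le_left ((s - 1) / s) (D * (s - 1) / s ^ 2)
    rwa [le_div_iff₀ hs0] at this
  have hε2 : ε * s * s ≤ D * (s - 1) := by
    have := min_le_right ((s - 1) / s) (D * (s - 1) / s ^ 2)
    rw [le_div_iff₀ (by positivity)] at this
    linarith [show ε * s * s = ε * s ^ 2 by ring]
  have hnn : inner ℝ n n = (1 : ℝ) := by rw [real_inner_self_eq_norm_sq, hn]; norm_num
  have hQn : ∀ x : E, inner ℝ n (squeeze n 0 x) = 0 := fun x => by
    rw [squeeze_apply, inner_sub_right, inner_smul_right, hnn]; ring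
  have hQ1 : ∀ x : E, ‖squeeze n 0 x‖ ≤ ‖x‖ := norm_squeeze_le hn le_rfl zero_le_one
  have hdiff : ∀ h : E, |inner ℝ n h| ≤ ε * ‖h‖ → ‖h - squeeze n 0 h‖ ≤ ε * ‖h‖ := by
    intro h hh
    rw [squeeze_apply]
    simpa [norm_smul, hn] using hh
  have ha : ∀ h : E, |inner ℝ n h| ≤ ε * ‖h‖ → ‖h‖ ≤ s * ‖squeeze n 0 h‖ := by
    intro h hh
    have h3 : ‖h‖ - ε * ‖h‖ ≤ ‖squeeze n 0 h‖ := by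
      have := norm_sub_norm_le h (squeeze n 0 h)
      linarith [hdiff h hh]
    nlinarith [norm_nonneg h, mul_le_mul_of_nonneg_left h3 hs0.le,
      mul_le_mul_of_nonneg_right hε1 (norm_nonneg h)]
  have hb : ∀ h : E, |inner ℝ n h| ≤ ε * ‖h‖ →
      s * (ε * ‖h‖) ≤ (s - 1) * ‖squeeze e δ (squeeze n 0 h)‖ := by
    intro h hh
    have h4 := squeezeFactor_mul_norm_le he hn h0 h1 (hQn h)
    calc s * (ε * ‖h‖) ≤ s * (ε * (s * ‖squeeze n 0 h‖)) := by gcongr; exact ha h hh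
      _ = ε * s * s * ‖squeeze n 0 h‖ := by ring
      _ ≤ D * (s - 1) * ‖squeeze n 0 h‖ := by gcongr
      _ = (s - 1) * (D * ‖squeeze n 0 h‖) := by ring
      _ ≤ _ := mul_le_mul_of_nonneg_left h4 (by linarith)
  have hΛ : ∀ h : E, |inner ℝ n h| ≤ ε * ‖h‖ →
      ‖squeeze e δ h - squeeze e δ (squeeze n 0 h)‖ ≤ ε * ‖h‖ := by
    intro h hh
    rw [← map_sub]
    exact (norm_squeeze_le he h0 h1 _).trans (hdiff h hh)
  have hup : ∀ h : E, |inner ℝ n h| ≤ ε * ‖h‖ →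
      ‖squeeze e δ h‖ ≤ s * ‖squeeze e δ (squeeze n 0 h)‖ := by
    intro h hh
    have h5 := norm_sub_norm_le (squeeze e δ h) (squeeze e δ (squeeze n 0 h))
    have h6 : ε * ‖h‖ ≤ s * (ε * ‖h‖) :=
      le_mul_of_one_le_left (mul_nonneg hε0 (norm_nonneg h)) hs.le
    linarith [hΛ h hh, hb h hh]
  have hlo : ∀ h : E, |inner ℝ n h| ≤ ε * ‖h‖ →
      ‖squeeze e δ (squeeze n 0 h)‖ ≤ s * ‖squeeze e δ h‖ := by
    intro h hh
    have h5 := norm_sub_norm_le (squeeze e δ (squeeze n 0 h)) (squeeze e δ h)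
    rw [norm_sub_rev] at h5
    nlinarith [hΛ h hh, hb h hh]
  have hQA : ∀ w ∈ squeeze n 0 '' A, inner ℝ n w = 0 := by
    rintro _ ⟨x, -, rfl⟩; exact hQn x
  have hlin : σ (squeeze e δ '' (squeeze n 0 '' A)) = ENNReal.ofReal D * σ (squeeze n 0 '' A) :=
    euclideanHausdorffMeasure_squeeze_image he hn δ hQA
  have hskt : s ^ k ≤ t := (pow_le_pow_right₀ hs.le (by omega)).trans hst
  have c1 : σ (squeeze e δ '' A) ≤ ENNReal.ofReal (s ^ k) *
      σ (squeeze e δ '' (squeeze n 0 '' A)) := by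
    rw [Set.image_image]
    refine euclideanHausdorffMeasure_image_le_of_dist_le hs0.le (fun x hx y hy => ?_) k
    simpa only [dist_eq_norm, ← map_sub] using hup _ (hA x hx y hy)
  have c2 : σ (squeeze e δ '' (squeeze n 0 '' A)) ≤ ENNReal.ofReal (s ^ k) *
      σ (squeeze e δ '' A) := by
    rw [Set.image_image]
    refine euclideanHausdorffMeasure_image_le_of_dist_le hs0.le (fun x hx y hy => ?_) k
    simpa only [dist_eq_norm, ← map_sub] using hlo _ (hA x hx y hy)
  have c3 : σ (squeeze n 0 '' A) ≤ σ A := by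
    have := euclideanHausdorffMeasure_image_le_of_dist_le (f := squeeze n 0) (g := id) (A := A)
      zero_le_one (fun x _ y _ => by simpa [dist_eq_norm, ← map_sub] using hQ1 (x - y)) k
    simpa using this
  have c4 : σ A ≤ ENNReal.ofReal (s ^ k) * σ (squeeze n 0 '' A) := by
    have := euclideanHausdorffMeasure_image_le_of_dist_le (f := id) (g := squeeze n 0) (A := A)
      hs0.le (fun x hx y hy => by
        simpa [dist_eq_norm, ← map_sub] using ha _ (hA x hx y hy)) k
    simpa using this
  refine ⟨fun x hx y hy hxy => ?_, ?_, ?_⟩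
  · have h7 := hlo _ (hA x hx y hy)
    have h8 := ha _ (hA x hx y hy)
    have h9 := squeezeFactor_mul_norm_le he hn h0 h1 (hQn (x - y))
    rw [map_sub (squeeze e δ) x y, hxy, sub_self, norm_zero, mul_zero] at h7
    have h10 : ‖squeeze n 0 (x - y)‖ ≤ 0 := by
      by_contra hc
      push Not at hc
      linarith [mul_pos hD hc]
    have h11 : ‖x - y‖ ≤ 0 := by nlinarith
    exact sub_eq_zero.1 (norm_le_zero_iff.1 h11)
  · calc σ (squeeze e δ '' A) ≤ _ := c1
      _ ≤ ENNReal.ofReal t * (ENNReal.ofReal D * σ A) := by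
        rw [hlin]; gcongr
  · calc ENNReal.ofReal D * σ A ≤ ENNReal.ofReal D * (ENNReal.ofReal (s ^ k) *
          σ (squeeze n 0 '' A)) := by gcongr
      _ = ENNReal.ofReal (s ^ k) * (ENNReal.ofReal D * σ (squeeze n 0 '' A)) := by ring
      _ ≤ ENNReal.ofReal (s ^ k) * (ENNReal.ofReal (s ^ k) * σ (squeeze e δ '' A)) := by
        rw [← hlin]; gcongr
      _ = ENNReal.ofReal (s ^ (2 * k)) * σ (squeeze e δ '' A) := by
        rw [← mul_assoc, ← ENNReal.ofReal_mul (by positivity), ← pow_add, two_mul]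
      _ ≤ _ := by gcongr

end Flat

end

section

/-! ### Outward normal and local flatness of the boundary -/

section Boundary

variable {d : ℕ} {Ω : Set (Sp d)}

theorem eventually_neg_of_inner_gradient_neg {ρ : Sp d → ℝ} {x g w : Sp d}
    (hρ : HasGradientAt ρ g x) (h0 : ρ x = 0) (hw : inner ℝ g w < 0) :
    ∀ᶠ s : ℝ in 𝓝[>] 0, ρ (x + s • w) < 0 := by
  have h1 : HasDerivAt (fun s : ℝ => ρ (x + s • w)) (inner ℝ g w) 0 := by
    have h2 : HasDerivAt (fun s : ℝ => x + s • w) w 0 := by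
      simpa using ((hasDerivAt_id (0 : ℝ)).smul_const w).const_add x
    have h3 : HasFDerivAt ρ ((InnerProductSpace.toDual ℝ _) g) (x + (0 : ℝ) • w) := by
      simpa using hρ.hasFDerivAt
    have h5 := h3.comp_hasDerivAt (0 : ℝ) h2
    rw [InnerProductSpace.toDual_apply_apply] at h5
    exact h5
  have h4 := h1.tendsto_slope.mono_left
    (nhdsWithin_mono (0 : ℝ) (fun s (hs : 0 < s) => hs.ne'))
  filter_upwards [h4.eventually_lt_const hw, self_mem_nhdsWithin] with s hs hs0
  rw [slope_def_field] at hs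
  simp only [zero_smul, add_zero, h0, sub_zero] at hs
  exact ((div_neg_iff.1 hs).resolve_left (fun h => absurd h.2 (not_lt.2 (le_of_lt hs0)))).1

theorem inner_gradient_nonpos_of_eventually_neg {ρ : Sp d → ℝ} {x g w : Sp d}
    (hρ : HasGradientAt ρ g x) (h0 : ρ x = 0) (hw : ∀ᶠ s : ℝ in 𝓝[>] 0, ρ (x + s • w) < 0) :
    inner ℝ g w ≤ 0 := by
  by_contra hc
  push Not at hc
  have h1 : HasGradientAt (fun y => -ρ y) (-g) x := by
    have := hρ.hasFDerivAt.neg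
    rw [hasGradientAt_iff_hasFDerivAt, map_neg]
    exact this
  have h2 := eventually_neg_of_inner_gradient_neg (w := w) h1 (by simp [h0])
    (by simpa [inner_neg_left] using hc)
  obtain ⟨s, hs1, hs2⟩ := (h2.and hw).exists
  linarith

/-- `ρ` is a `C¹` defining function of `Ω` on the open set `U`. -/
structure DefinesOn (Ω : Set (Sp d)) (ρ : Sp d → ℝ) (U : Set (Sp d)) : Prop where
  isOpen : IsOpen U
  contDiffOn : ContDiffOn ℝ 1 ρ U
  gradient_ne_zero : ∀ y ∈ U, gradient ρ y ≠ 0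
  mem_iff : ∀ y ∈ U, y ∈ Ω ↔ ρ y < 0

namespace DefinesOn

variable {ρ : Sp d → ℝ} {U : Set (Sp d)}

theorem contDiffAt (h : DefinesOn Ω ρ U) {x : Sp d} (hx : x ∈ U) : ContDiffAt ℝ 1 ρ x :=
  h.contDiffOn.contDiffAt (h.isOpen.mem_nhds hx)

theorem hasGradientAt (h : DefinesOn Ω ρ U) {x : Sp d} (hx : x ∈ U) :
    HasGradientAt ρ (gradient ρ x) x :=
  ((h.contDiffAt hx).differentiableAt one_ne_zero).hasGradientAt

theorem eq_zero (h : DefinesOn Ω ρ U) (hΩ : IsOpen Ω) {x : Sp d} (hx : x ∈ U)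
    (hxf : x ∈ frontier Ω) : ρ x = 0 := by
  rw [hΩ.frontier_eq] at hxf
  refine le_antisymm ?_ (not_lt.1 fun hc => hxf.2 ((h.mem_iff x hx).2 hc))
  by_contra hc
  push Not at hc
  have h1 : ∀ᶠ y in 𝓝 x, y ∈ U ∧ 0 < ρ y :=
    (h.isOpen.eventually_mem hx).and ((h.contDiffAt hx).continuousAt.eventually_const_lt hc)
  obtain ⟨y, hy, hyΩ⟩ := mem_closure_iff_nhds.1 hxf.1 _ h1
  have := (h.mem_iff y hy.1).1 hyΩ
  linarith [hy.2]

theorem eventually_mem (h : DefinesOn Ω ρ U) {x : Sp d} (hx : x ∈ U) (w : Sp d) :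
    ∀ᶠ s : ℝ in 𝓝[>] 0, x + s • w ∈ U := by
  have hc : Continuous fun s : ℝ => x + s • w := by fun_prop
  have : Tendsto (fun s : ℝ => x + s • w) (𝓝[>] 0) (𝓝 x) :=
    (hc.tendsto' 0 x (by simp)).mono_left nhdsWithin_le_nhds
  exact this (h.isOpen.mem_nhds hx)

theorem eventually_mem_of_inner_neg (h : DefinesOn Ω ρ U) (hΩ : IsOpen Ω) {x : Sp d} (hx : x ∈ U)
    (hxf : x ∈ frontier Ω) {w : Sp d} (hw : inner ℝ (gradient ρ x) w < 0) :
    ∀ᶠ s : ℝ in 𝓝[>] 0, x + s • w ∈ Ω := by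
  filter_upwards [h.eventually_mem hx w, eventually_neg_of_inner_gradient_neg
    (h.hasGradientAt hx) (h.eq_zero hΩ hx hxf) hw] with s hs1 hs2
  exact (h.mem_iff _ hs1).2 hs2

theorem inner_nonpos_of_eventually_mem (h : DefinesOn Ω ρ U) (hΩ : IsOpen Ω) {x : Sp d}
    (hx : x ∈ U) (hxf : x ∈ frontier Ω) {w : Sp d} (hw : ∀ᶠ s : ℝ in 𝓝[>] 0, x + s • w ∈ Ω) :
    inner ℝ (gradient ρ x) w ≤ 0 := by
  refine inner_gradient_nonpos_of_eventually_neg (h.hasGradientAt hx) (h.eq_zero hΩ hx hxf) ?_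
  filter_upwards [h.eventually_mem hx w, hw] with s hs1 hs2
  exact (h.mem_iff _ hs1).1 hs2

/-- A direction with negative derivative of one defining function enters `Ω`, so the other cannot
have positive derivative along it. If the unit gradients `a ≠ b` differed, the direction `b - a`
would violate this. -/
theorem normalized_gradient_eq (h : DefinesOn Ω ρ U) (hΩ : IsOpen Ω) {ρ' : Sp d → ℝ}
    {U' : Set (Sp d)} (h' : DefinesOn Ω ρ' U') {x : Sp d} (hx : x ∈ U) (hx' : x ∈ U')
    (hxf : x ∈ frontier Ω) :
    ‖gradient ρ x‖⁻¹ • gradient ρ x = ‖gradient ρ' x‖⁻¹ • gradient ρ' x := by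
  set g := gradient ρ x
  set g' := gradient ρ' x
  have hg : 0 < ‖g‖ := norm_pos_iff.2 (h.gradient_ne_zero x hx)
  have hg' : 0 < ‖g'‖ := norm_pos_iff.2 (h'.gradient_ne_zero x hx')
  have key : ∀ w, inner ℝ g w < 0 → inner ℝ g' w ≤ 0 := fun w hw =>
    h'.inner_nonpos_of_eventually_mem hΩ hx' hxf (h.eventually_mem_of_inner_neg hΩ hx hxf hw)
  by_contra hne
  set a := ‖g‖⁻¹ • g with ha
  set b := ‖g'‖⁻¹ • g' with hb
  have ha1 : ‖a‖ = 1 := by rw [ha, norm_smul, norm_inv, norm_norm, inv_mul_cancel₀ hg.ne']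
  have hb1 : ‖b‖ = 1 := by rw [hb, norm_smul, norm_inv, norm_norm, inv_mul_cancel₀ hg'.ne']
  have hlt : inner ℝ a b < 1 := (inner_lt_one_iff_real_of_norm_eq_one ha1 hb1).2 hne
  have h1 : inner ℝ a (b - a) < 0 := by
    rw [inner_sub_right, real_inner_self_eq_norm_sq, ha1]; linarith
  have h2 : 0 < inner ℝ b (b - a) := by
    rw [inner_sub_right, real_inner_self_eq_norm_sq, hb1, real_inner_comm]; linarith
  have h3 : inner ℝ g (b - a) < 0 := by
    rw [ha, inner_smul_left] at h1
    simp only [RCLike.conj_to_real] at h1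
    exact neg_of_mul_neg_right h1 (inv_pos.2 hg).le
  have h4 : 0 < inner ℝ g' (b - a) := by
    rw [hb, inner_smul_left] at h2
    simp only [RCLike.conj_to_real] at h2
    exact pos_of_mul_pos_right h2 (inv_pos.2 hg').le
  exact absurd (key _ h3) (not_le.2 h4)

theorem outerNormal_eq (h : DefinesOn Ω ρ U) (hΩ : IsOpen Ω) {x : Sp d} (hx : x ∈ U)
    (hxf : x ∈ frontier Ω) : outerNormal Ω x = ‖gradient ρ x‖⁻¹ • gradient ρ x := by
  have hex : x ∈ frontier Ω ∧ ∃ ρ : Sp d → ℝ, IsDefiningFunctionAt Ω x ρ :=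
    ⟨hxf, ρ, U, h.isOpen, hx, h.contDiffOn, h.gradient_ne_zero, h.mem_iff⟩
  rw [outerNormal, dif_pos hex]
  obtain ⟨U', h1, h2, h3, h4, h5⟩ := hex.2.choose_spec
  exact (DefinesOn.mk h1 h3 h4 h5).normalized_gradient_eq hΩ h h2 hx hxf

theorem continuousAt_gradient (h : DefinesOn Ω ρ U) {x : Sp d} (hx : x ∈ U) :
    ContinuousAt (gradient ρ) x := by
  have h1 : ContinuousAt (fderiv ℝ ρ) x := (h.contDiffAt hx).continuousAt_fderiv one_ne_zero
  exact (InnerProductSpace.toDual ℝ (Sp d)).symm.continuous.continuousAt.comp h1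

end DefinesOn

theorem HasC1Boundary.exists_definesOn (hb : HasC1Boundary Ω) {x : Sp d} (hx : x ∈ frontier Ω) :
    ∃ ρ U, x ∈ U ∧ DefinesOn Ω ρ U := by
  obtain ⟨ρ, U, h1, h2, h3, h4, h5⟩ := hb x hx
  exact ⟨ρ, U, h2, h1, h3, h4, h5⟩

theorem norm_outerNormal (hΩ : IsOpen Ω) (hb : HasC1Boundary Ω) {x : Sp d}
    (hx : x ∈ frontier Ω) : ‖outerNormal Ω x‖ = 1 := by
  obtain ⟨ρ, U, hxU, h⟩ := hb.exists_definesOn hx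
  rw [h.outerNormal_eq hΩ hxU hx, norm_smul, norm_inv, norm_norm,
    inv_mul_cancel₀ (norm_pos_iff.2 (h.gradient_ne_zero x hxU)).ne']

theorem continuousOn_outerNormal (hΩ : IsOpen Ω) (hb : HasC1Boundary Ω) :
    ContinuousOn (outerNormal Ω) (frontier Ω) := by
  intro x hx
  obtain ⟨ρ, U, hxU, h⟩ := hb.exists_definesOn hx
  have h1 : ContinuousAt (fun y => ‖gradient ρ y‖⁻¹ • gradient ρ y) x :=
    ((h.continuousAt_gradient hxU).norm.inv₀
      (norm_pos_iff.2 (h.gradient_ne_zero x hxU)).ne').smul (h.continuousAt_gradient hxU)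
  refine h1.continuousWithinAt.congr_of_eventuallyEq ?_ (h.outerNormal_eq hΩ hxU hx)
  filter_upwards [self_mem_nhdsWithin, mem_nhdsWithin_of_mem_nhds (h.isOpen.mem_nhds hxU)]
    with y hy1 hy2
  exact h.outerNormal_eq hΩ hy2 hy1

theorem measurable_outerNormal (hΩ : IsOpen Ω) (hb : HasC1Boundary Ω) :
    Measurable (outerNormal Ω) := by
  classical
  have h1 : Measurable ((frontier Ω).piecewise (outerNormal Ω) fun _ => 0) :=
    (continuousOn_outerNormal hΩ hb).measurable_piecewise continuousOn_const
      isClosed_frontier.measurableSet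
  convert h1 using 1
  ext1 x
  by_cases hx : x ∈ frontier Ω
  · simp [hx]
  · simp [hx, outerNormal]

theorem eventually_mem_of_inner_outerNormal_neg (hΩ : IsOpen Ω) (hb : HasC1Boundary Ω) {x w : Sp d}
    (hx : x ∈ frontier Ω) (hw : inner ℝ w (outerNormal Ω x) < 0) :
    ∀ᶠ s : ℝ in 𝓝[>] 0, x + s • w ∈ Ω := by
  obtain ⟨ρ, U, hxU, h⟩ := hb.exists_definesOn hx
  refine h.eventually_mem_of_inner_neg hΩ hxU hx ?_
  rw [h.outerNormal_eq hΩ hxU hx, inner_smul_right, real_inner_comm] at hw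
  exact neg_of_mul_neg_right hw (inv_nonneg.2 (norm_nonneg _))

theorem inner_outerNormal_nonpos_of_eventually_mem (hΩ : IsOpen Ω) (hb : HasC1Boundary Ω)
    {x w : Sp d} (hx : x ∈ frontier Ω) (hw : ∀ᶠ s : ℝ in 𝓝[>] 0, x + s • w ∈ Ω) :
    inner ℝ w (outerNormal Ω x) ≤ 0 := by
  obtain ⟨ρ, U, hxU, h⟩ := hb.exists_definesOn hx
  have h1 := h.inner_nonpos_of_eventually_mem hΩ hxU hx hw
  rw [h.outerNormal_eq hΩ hxU hx, inner_smul_right, real_inner_comm]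
  exact mul_nonpos_of_nonneg_of_nonpos (inv_nonneg.2 (norm_nonneg _)) h1

/-- A defining function vanishes on the frontier and is strictly differentiable at `x₀`, so its
derivative at `x₀` applied to `x - y` is `o(‖x - y‖)`, uniformly in both points. -/
theorem exists_flat_neighborhood (hΩ : IsOpen Ω) (hb : HasC1Boundary Ω) {x₀ : Sp d}
    (hx₀ : x₀ ∈ frontier Ω) {ε : ℝ} (hε : 0 < ε) :
    ∃ U : Set (Sp d), IsOpen U ∧ x₀ ∈ U ∧ ∀ x ∈ frontier Ω ∩ U, ∀ y ∈ frontier Ω ∩ U,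
      |inner ℝ (outerNormal Ω x₀) (x - y)| ≤ ε * ‖x - y‖ := by
  obtain ⟨ρ, U, hxU, h⟩ := hb.exists_definesOn hx₀
  have hg : 0 < ‖gradient ρ x₀‖ := norm_pos_iff.2 (h.gradient_ne_zero x₀ hxU)
  have h1 : HasStrictFDerivAt ρ (fderiv ℝ ρ x₀) x₀ :=
    (h.contDiffAt hxU).hasStrictFDerivAt one_ne_zero
  have h2 := h1.isLittleO.def (mul_pos hε hg)
  rw [nhds_prod_eq] at h2
  obtain ⟨t, ht, h3⟩ := eventually_prod_self_iff'.1 h2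
  obtain ⟨V, hVt, hV, hxV⟩ := mem_nhds_iff.1 ht
  refine ⟨U ∩ V, h.isOpen.inter hV, ⟨hxU, hxV⟩, fun x hx y hy => ?_⟩
  have h4 := h3 x (hVt hx.2.2) y (hVt hy.2.2)
  simp only [h.eq_zero hΩ hx.2.1 hx.1, h.eq_zero hΩ hy.2.1 hy.1, sub_zero, zero_sub, norm_neg] at h4
  have h5 : fderiv ℝ ρ x₀ (x - y) = inner ℝ (gradient ρ x₀) (x - y) := by
    rw [gradient, InnerProductSpace.toDual_symm_apply]
  rw [h5, Real.norm_eq_abs] at h4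
  rw [h.outerNormal_eq hΩ hxU hx₀, inner_smul_left, RCLike.conj_to_real, abs_mul, abs_inv, abs_norm,
    inv_mul_le_iff₀ hg]
  linarith

theorem exists_isOpen_squeeze_estimate (hΩ : IsOpen Ω) (hb : HasC1Boundary Ω) {x₀ e : Sp d}
    (hx₀ : x₀ ∈ frontier Ω) (he : ‖e‖ = 1) {δ : ℝ} (h0 : 0 ≤ δ) (h1 : δ ≤ 1)
    (hD : 0 < squeezeFactor (inner ℝ e (outerNormal Ω x₀)) δ) {t : ℝ} (ht : 1 < t) :
    ∃ U : Set (Sp d), IsOpen U ∧ x₀ ∈ U ∧ ∀ A ⊆ frontier Ω ∩ U,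
      Set.InjOn (squeeze e δ) A ∧
      (Measure.euclideanHausdorffMeasure (d - 1) : Measure (Sp d)) (squeeze e δ '' A) ≤
        ENNReal.ofReal t * (ENNReal.ofReal (squeezeFactor (inner ℝ e (outerNormal Ω x₀)) δ) *
          (Measure.euclideanHausdorffMeasure (d - 1) : Measure (Sp d)) A) ∧
      ENNReal.ofReal (squeezeFactor (inner ℝ e (outerNormal Ω x₀)) δ) *
          (Measure.euclideanHausdorffMeasure (d - 1) : Measure (Sp d)) A ≤
        ENNReal.ofReal t *
          (Measure.euclideanHausdorffMeasure (d - 1) : Measure (Sp d)) (squeeze e δ '' A) := by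
  obtain ⟨ε, hε, h2⟩ := exists_flatness he (norm_outerNormal hΩ hb hx₀) h0 h1 hD ht
  obtain ⟨U, hU, hxU, h3⟩ := exists_flat_neighborhood hΩ hb hx₀ hε
  rw [finrank_euclideanSpace_fin] at h2
  exact ⟨U, hU, hxU, fun A hA => h2 A fun x hx y hy => h3 x (hA hx) y (hA hy)⟩

end Boundary

end

/-! ### Surface area, tangential points and the local area formula -/

section

/-- Lindelöf gives a countable subcover. Heredity of `p` lets the sets be made disjoint. -/
theorem exists_countable_measurable_partition {X : Type*} [TopologicalSpace X]
    [SecondCountableTopology X] [MeasurableSpace X] [OpensMeasurableSpace X] {S : Set X}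
    {p : Set X → Prop} (hmono : ∀ U V, U ⊆ V → p V → p U) (hempty : p ∅)
    (hloc : ∀ x ∈ S, ∃ U, IsOpen U ∧ x ∈ U ∧ p U) :
    ∃ W : ℕ → Set X, (∀ i, MeasurableSet (W i)) ∧ Pairwise (Function.onFun Disjoint W) ∧
      S ⊆ ⋃ i, W i ∧ ∀ i, p (W i) := by
  classical
  choose! U hU hxU hpU using hloc
  obtain ⟨t, hts, htc, hcov⟩ := TopologicalSpace.countable_cover_nhdsWithin
    (fun x hx => mem_nhdsWithin_of_mem_nhds ((hU x hx).mem_nhds (hxU x hx)))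
  rcases t.eq_empty_or_nonempty with rfl | hne
  · refine ⟨fun _ => ∅, fun _ => MeasurableSet.empty, fun i j _ => by simp [Function.onFun], ?_,
      fun _ => hempty⟩
    simpa using hcov
  · obtain ⟨f, hf⟩ := htc.exists_eq_range hne
    have hft : ∀ i, f i ∈ S := fun i => hts (hf ▸ Set.mem_range_self i)
    refine ⟨disjointed fun i => U (f i), ?_, disjoint_disjointed _, ?_, fun i =>
      hmono _ _ (disjointed_le _ i) (hpU _ (hft i))⟩
    · intro i
      exact MeasurableSet.disjointed (fun j => (hU _ (hft j)).measurableSet) i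
    · rw [iUnion_disjointed]
      rw [hf, Set.biUnion_range] at hcov
      exact hcov

variable {d : ℕ} {Ω : Set (Sp d)}

theorem euclideanHausdorffMeasure_lt_top_of_subset_hyperplane {n : Sp d} (hn : ‖n‖ = 1)
    {B : Set (Sp d)} (hB : ∀ w ∈ B, inner ℝ n w = 0) (hb : Bornology.IsBounded B) :
    (Measure.euclideanHausdorffMeasure (d - 1) : Measure (Sp d)) B < ∞ := by
  set W : Submodule ℝ (Sp d) := (Submodule.span ℝ {n})ᗮ with hW
  have hBW : B = W.subtypeₗᵢ '' (Subtype.val ⁻¹' B : Set W) := by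
    ext x
    constructor
    · intro hx
      exact ⟨⟨x, Submodule.mem_orthogonal_singleton_iff_inner_right.2 (hB x hx)⟩, hx, rfl⟩
    · rintro ⟨y, hy, rfl⟩
      exact hy
  have hfr : Module.finrank ℝ W = d - 1 := by
    rw [hW, finrank_orthogonal_unit hn, finrank_euclideanSpace_fin]
  rw [hBW, W.subtypeₗᵢ.isometry.euclideanHausdorffMeasure_image, ← hfr,
    InnerProductSpace.euclideanHausdorffMeasure_eq_volume]
  refine Bornology.IsBounded.measure_lt_top ?_
  rw [Metric.isBounded_iff] at hb ⊢
  obtain ⟨C, hC⟩ := hb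
  exact ⟨C, fun x hx y hy => hC hx hy⟩

/-- Near each point, project along the normal at that point: the volume factor is 1 and the image is
a bounded subset of a hyperplane. Compactness of the frontier globalizes the bound. -/
theorem surfaceMeasure_frontier_lt_top (hΩ : IsOpen Ω) (hbd : Bornology.IsBounded Ω)
    (hb : HasC1Boundary Ω) :
    (Measure.euclideanHausdorffMeasure (d - 1) : Measure (Sp d)) (frontier Ω) < ∞ := by
  have hcomp : IsCompact (frontier Ω) :=
    hbd.isCompact_closure.of_isClosed_subset isClosed_frontier frontier_subset_closure
  refine hcomp.measure_lt_top_of_nhdsWithin fun x hx => ?_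
  have hn := norm_outerNormal hΩ hb hx
  have hD : squeezeFactor (inner ℝ (outerNormal Ω x) (outerNormal Ω x)) 0 = 1 := by
    rw [squeezeFactor_zero, real_inner_self_eq_norm_sq, hn]; norm_num
  obtain ⟨U, hU, hxU, h⟩ := exists_isOpen_squeeze_estimate hΩ hb hx hn le_rfl zero_le_one
    (by rw [hD]; norm_num) one_lt_two
  refine ⟨frontier Ω ∩ U, inter_mem_nhdsWithin _ (hU.mem_nhds hxU), ?_⟩
  obtain ⟨-, -, h3⟩ := h _ le_rfl
  rw [hD, ENNReal.ofReal_one, one_mul] at h3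
  refine h3.trans_lt (ENNReal.mul_lt_top ENNReal.ofReal_lt_top ?_)
  refine euclideanHausdorffMeasure_lt_top_of_subset_hyperplane hn ?_ ?_
  · rintro _ ⟨y, -, rfl⟩
    rw [squeeze_apply, inner_sub_right, inner_smul_right, real_inner_self_eq_norm_sq, hn]; ring
  · exact (hcomp.isBounded.subset Set.inter_subset_left).image (squeeze (outerNormal Ω x) 0)

theorem isFiniteMeasure_surfaceMeasure (hΩ : IsOpen Ω) (hbd : Bornology.IsBounded Ω)
    (hb : HasC1Boundary Ω) : IsFiniteMeasure (surfaceMeasure Ω) :=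
  ⟨by simpa [surfaceMeasure] using surfaceMeasure_frontier_lt_top hΩ hbd hb⟩

theorem measurable_inner_outerNormal (hΩ : IsOpen Ω) (hb : HasC1Boundary Ω) (e : Sp d) :
    Measurable fun x => (inner ℝ e (outerNormal Ω x) : ℝ) :=
  measurable_const.inner (measurable_outerNormal hΩ hb)

/-- The projection along `e` of the set of boundary points at which `e` is tangential is null. -/
theorem euclideanHausdorffMeasure_projection_glancing (hΩ : IsOpen Ω)
    (hbd : Bornology.IsBounded Ω) (hb : HasC1Boundary Ω) {e : Sp d} (he : ‖e‖ = 1) :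
    (Measure.euclideanHausdorffMeasure (d - 1) : Measure (Sp d))
      (squeeze e 0 '' {x | x ∈ frontier Ω ∧ inner ℝ e (outerNormal Ω x) = 0}) = 0 := by
  set G := {x | x ∈ frontier Ω ∧ inner ℝ e (outerNormal Ω x) = 0} with hG
  set σ := (Measure.euclideanHausdorffMeasure (d - 1) : Measure (Sp d))
  have hGm : MeasurableSet G := isClosed_frontier.measurableSet.inter
    ((measurable_inner_outerNormal hΩ hb e) (measurableSet_singleton 0))
  -- The full projection has volume factor 0 at tangential points, where the flatness estimate does
  -- not apply. For `δ > 0` the factor is exactly `δ`, and the projection is 1-Lipschitz after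
  -- `squeeze e δ`. Then `δ → 0`.
  have key : ∀ δ : ℝ, 0 < δ → δ ≤ 1 →
      σ (squeeze e 0 '' G) ≤ ENNReal.ofReal δ * (ENNReal.ofReal 2 * σ (frontier Ω)) := by
    intro δ hδ hδ1
    have h1 : σ (squeeze e 0 '' G) ≤ σ (squeeze e δ '' G) := by
      have := euclideanHausdorffMeasure_image_le_of_dist_le (f := squeeze e 0) (g := squeeze e δ)
        (A := G) zero_le_one (fun x _ y _ => by
          rw [dist_eq_norm, dist_eq_norm, ← map_sub, ← map_sub, one_mul,
            ← squeeze_zero_squeeze he δ (x - y)]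
          exact norm_squeeze_le he le_rfl zero_le_one _) (d - 1)
      simpa using this
    obtain ⟨W, hWm, hWd, hcov, hW⟩ := exists_countable_measurable_partition (S := G)
      (p := fun U => ∀ A ⊆ G ∩ U, σ (squeeze e δ '' A) ≤
        ENNReal.ofReal 2 * (ENNReal.ofReal δ * σ A))
      (fun U V hUV hV A hA => hV A (hA.trans (by gcongr)))
      (fun A hA => by
        have : A = ∅ := by simpa using hA
        simp [this])
      (fun x hx => by
        have hD : squeezeFactor (inner ℝ e (outerNormal Ω x)) δ = δ := by
          rw [hx.2, squeezeFactor_zero_left hδ.le]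
        obtain ⟨U, hU, hxU, h⟩ := exists_isOpen_squeeze_estimate hΩ hb hx.1 he hδ.le hδ1
          (by rwa [hD]) one_lt_two
        refine ⟨U, hU, hxU, fun A hA => ?_⟩
        have := (h A fun y hy => ⟨(hA hy).1.1, (hA hy).2⟩).2.1
        rwa [hD] at this)
    have hGU : G = ⋃ i, G ∩ W i := by
      rw [← Set.inter_iUnion, Set.inter_eq_left.2 hcov]
    calc σ (squeeze e 0 '' G) ≤ σ (squeeze e δ '' G) := h1
      _ = σ (⋃ i, squeeze e δ '' (G ∩ W i)) := by rw [← Set.image_iUnion, ← hGU]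
      _ ≤ ∑' i, σ (squeeze e δ '' (G ∩ W i)) := measure_iUnion_le _
      _ ≤ ∑' i, ENNReal.ofReal 2 * (ENNReal.ofReal δ * σ (G ∩ W i)) :=
        ENNReal.tsum_le_tsum fun i => hW i _ le_rfl
      _ = ENNReal.ofReal 2 * (ENNReal.ofReal δ * σ (⋃ i, G ∩ W i)) := by
        rw [ENNReal.tsum_mul_left, ENNReal.tsum_mul_left, measure_iUnion]
        · exact fun i j hij => (hWd hij).mono Set.inter_subset_right Set.inter_subset_right
        · exact fun i => hGm.inter (hWm i)
      _ ≤ ENNReal.ofReal 2 * (ENNReal.ofReal δ * σ (frontier Ω)) := by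
        rw [← hGU]; gcongr; exact fun x hx => hx.1
      _ = _ := by ring
  have hlim : Tendsto (fun δ : ℝ => ENNReal.ofReal δ * (ENNReal.ofReal 2 * σ (frontier Ω)))
      (𝓝[>] 0) (𝓝 0) := by
    have h2 : Tendsto (fun δ : ℝ => ENNReal.ofReal δ) (𝓝[>] 0) (𝓝 0) :=
      (ENNReal.continuous_ofReal.tendsto' 0 0 ENNReal.ofReal_zero).mono_left nhdsWithin_le_nhds
    have h3 := ENNReal.Tendsto.mul_const (b := ENNReal.ofReal 2 * σ (frontier Ω)) h2
      (Or.inr (ENNReal.mul_lt_top ENNReal.ofReal_lt_top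
        (surfaceMeasure_frontier_lt_top hΩ hbd hb)).ne)
    simpa using h3
  refine le_antisymm (ge_of_tendsto hlim ?_) zero_le
  filter_upwards [Ioc_mem_nhdsGT (zero_lt_one' ℝ)] with δ hδ
  exact key δ hδ.1 hδ.2

/-- The area formula for the projection along `e`, up to a factor `t > 1`, on small pieces of the
boundary that are transversal to `e`. -/
theorem exists_isOpen_area_estimate (hΩ : IsOpen Ω) (hb : HasC1Boundary Ω) {x₀ e : Sp d}
    (hx₀ : x₀ ∈ frontier Ω) (he : ‖e‖ = 1) (hne : inner ℝ e (outerNormal Ω x₀) ≠ 0) {t : ℝ}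
    (ht : 1 < t) :
    ∃ U : Set (Sp d), IsOpen U ∧ x₀ ∈ U ∧ ∀ A ⊆ frontier Ω ∩ U, MeasurableSet A →
      ∫⁻ x in A, ENNReal.ofReal |inner ℝ e (outerNormal Ω x)|
          ∂(Measure.euclideanHausdorffMeasure (d - 1)) ≤
        ENNReal.ofReal t *
          (Measure.euclideanHausdorffMeasure (d - 1) : Measure (Sp d)) (squeeze e 0 '' A) ∧
      (Measure.euclideanHausdorffMeasure (d - 1) : Measure (Sp d)) (squeeze e 0 '' A) ≤
        ENNReal.ofReal t * ∫⁻ x in A, ENNReal.ofReal |inner ℝ e (outerNormal Ω x)|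
          ∂(Measure.euclideanHausdorffMeasure (d - 1)) := by
  set σ := (Measure.euclideanHausdorffMeasure (d - 1) : Measure (Sp d))
  set c := inner ℝ e (outerNormal Ω x₀) with hc
  have hc0 : 0 < |c| := abs_pos.2 hne
  -- One factor `s` pays for the flatness of the piece, the other for the variation of `|e · n|`
  -- over it.
  obtain ⟨s, hs, hst⟩ := exists_one_lt_pow_le ht 2
  have hs0 : 0 < s := by linarith
  have hD : squeezeFactor c 0 = |c| := squeezeFactor_zero c
  obtain ⟨U, hU, hxU, h⟩ := exists_isOpen_squeeze_estimate hΩ hb hx₀ he le_rfl zero_le_one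
    (by rwa [← hc, hD]) hs
  rw [← hc, hD] at h
  have hcont : ContinuousWithinAt (fun x => |inner ℝ e (outerNormal Ω x)|) (frontier Ω) x₀ :=
    (continuousWithinAt_const.inner (𝕜 := ℝ) (continuousOn_outerNormal hΩ hb x₀ hx₀)).abs
  have h1 : ∀ᶠ x in 𝓝[frontier Ω] x₀, |inner ℝ e (outerNormal Ω x)| < s * |c| :=
    hcont.eventually_lt_const (lt_mul_of_one_lt_left hc0 hs)
  have h2 : ∀ᶠ x in 𝓝[frontier Ω] x₀, |c| / s < |inner ℝ e (outerNormal Ω x)| :=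
    hcont.eventually_const_lt (div_lt_self hc0 hs)
  obtain ⟨V, hV, hxV, hVs⟩ := mem_nhdsWithin.1 (h1.and h2)
  refine ⟨U ∩ V, hU.inter hV, ⟨hxU, hxV⟩, fun A hA hAm => ?_⟩
  obtain ⟨-, h3, h4⟩ := h A fun x hx => ⟨(hA hx).1, (hA hx).2.1⟩
  have h5 : ∀ x ∈ A, |inner ℝ e (outerNormal Ω x)| < s * |c| ∧
      |c| / s < |inner ℝ e (outerNormal Ω x)| := fun x hx => hVs ⟨(hA hx).2.2, (hA hx).1⟩
  have hss : ENNReal.ofReal s * ENNReal.ofReal s ≤ ENNReal.ofReal t := by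
    rw [← ENNReal.ofReal_mul hs0.le, ← sq]
    exact ENNReal.ofReal_le_ofReal hst
  constructor
  · calc ∫⁻ x in A, ENNReal.ofReal |inner ℝ e (outerNormal Ω x)| ∂σ
        ≤ ∫⁻ x in A, ENNReal.ofReal (s * |c|) ∂σ :=
          setLIntegral_mono' hAm fun x hx => ENNReal.ofReal_le_ofReal (h5 x hx).1.le
      _ = ENNReal.ofReal s * (ENNReal.ofReal |c| * σ A) := by
          rw [setLIntegral_const, ENNReal.ofReal_mul hs0.le, mul_assoc]
      _ ≤ ENNReal.ofReal s * (ENNReal.ofReal s * σ (squeeze e 0 '' A)) := by gcongr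
      _ ≤ _ := by rw [← mul_assoc]; gcongr
  · calc σ (squeeze e 0 '' A) ≤ ENNReal.ofReal s * (ENNReal.ofReal |c| * σ A) := h3
      _ = ENNReal.ofReal s * (ENNReal.ofReal s * (ENNReal.ofReal (|c| / s) * σ A)) := by
          rw [← mul_assoc (ENNReal.ofReal s) (ENNReal.ofReal (|c| / s)),
            ← ENNReal.ofReal_mul hs0.le, mul_div_cancel₀ _ hs0.ne']
      _ = ENNReal.ofReal s * ENNReal.ofReal s * ∫⁻ x in A, ENNReal.ofReal (|c| / s) ∂σ := by
          rw [setLIntegral_const, mul_assoc]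
      _ ≤ ENNReal.ofReal t * ∫⁻ x in A, ENNReal.ofReal |inner ℝ e (outerNormal Ω x)| ∂σ := by
          refine mul_le_mul' hss (setLIntegral_mono' hAm fun x hx => ?_)
          exact ENNReal.ofReal_le_ofReal (h5 x hx).2.le

end

section

variable {d : ℕ} {Ω : Set (Sp d)}

/-! ### Backward exit time and exit point -/

section ExitTime

theorem bddBelow_exitSet (p : Sp d × Sp d) : BddBelow {s : ℝ | 0 < s ∧ p.1 - s • p.2 ∉ Ω} :=
  ⟨0, fun _ hs => hs.1.le⟩

theorem exitTime_nonneg (p : Sp d × Sp d) : 0 ≤ exitTime Ω p :=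
  Real.sInf_nonneg fun _ hs => hs.1.le

theorem exitSet_nonempty (hbd : Bornology.IsBounded Ω) {p : Sp d × Sp d} (hp : p.2 ≠ 0) :
    {s : ℝ | 0 < s ∧ p.1 - s • p.2 ∉ Ω}.Nonempty := by
  obtain ⟨R, hR⟩ := hbd.exists_norm_le
  have hv : 0 < ‖p.2‖ := norm_pos_iff.2 hp
  refine ⟨(|R| + ‖p.1‖ + 1) / ‖p.2‖, by positivity, fun hc => ?_⟩
  have h1 := hR _ hc
  have h2 : ‖((|R| + ‖p.1‖ + 1) / ‖p.2‖) • p.2‖ = |R| + ‖p.1‖ + 1 := by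
    rw [norm_smul, Real.norm_eq_abs, abs_of_nonneg (by positivity), div_mul_cancel₀ _ hv.ne']
  have h3 := norm_sub_norm_le (((|R| + ‖p.1‖ + 1) / ‖p.2‖) • p.2) p.1
  rw [norm_sub_rev] at h3
  linarith [le_abs_self R]

theorem mem_of_lt_exitTime {p : Sp d × Sp d} {s : ℝ} (h0 : 0 < s) (hs : s < exitTime Ω p) :
    p.1 - s • p.2 ∈ Ω := by
  by_contra hc
  exact absurd (csInf_le (bddBelow_exitSet p) ⟨h0, hc⟩) (not_le.2 hs)

theorem exitTime_lt_iff (hbd : Bornology.IsBounded Ω) {p : Sp d × Sp d} (hp : p.2 ≠ 0) {t : ℝ} :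
    exitTime Ω p < t ↔ ∃ s, 0 < s ∧ s < t ∧ p.1 - s • p.2 ∉ Ω := by
  rw [exitTime, csInf_lt_iff (bddBelow_exitSet p) (exitSet_nonempty hbd hp)]
  constructor
  · rintro ⟨s, ⟨h1, h2⟩, h3⟩; exact ⟨s, h1, h3, h2⟩
  · rintro ⟨s, h1, h3, h2⟩; exact ⟨s, ⟨h1, h2⟩, h3⟩

theorem exitTime_of_eq_zero {p : Sp d × Sp d} (hp : p.2 = 0) : exitTime Ω p = 0 := by
  by_cases h : p.1 ∈ Ω
  · simp [exitTime, hp, h]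
  · have : {s : ℝ | 0 < s ∧ p.1 - s • p.2 ∉ Ω} = Set.Ioi 0 := by
      ext s; simp [hp, h]
    rw [exitTime, this, csInf_Ioi]

theorem measurable_exitTime (hΩ : IsOpen Ω) (hbd : Bornology.IsBounded Ω) :
    Measurable (exitTime Ω) := by
  refine measurable_of_Iio fun t => ?_
  have h0 : MeasurableSet {p : Sp d × Sp d | p.2 = 0} :=
    (measurableSet_singleton (0 : Sp d)).preimage measurable_snd
  -- For nonzero velocity, `exitTime < t` means that the trajectory is outside `Ω` at some time in
  -- `(0, t)`. Exhausting this interval by compact ones gives a countable union of sets, each closed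
  -- by compactness in time.
  have hcl : ∀ n : ℕ, MeasurableSet {p : Sp d × Sp d |
      ∃ s ∈ Set.Icc (1 / ((n : ℝ) + 1)) (t - 1 / ((n : ℝ) + 1)), p.1 - s • p.2 ∉ Ω} := by
    intro n
    refine IsClosed.measurableSet ?_
    rw [← isOpen_compl_iff, isOpen_iff_eventually]
    intro p hp
    have hp' : ∀ s ∈ Set.Icc (1 / ((n : ℝ) + 1)) (t - 1 / ((n : ℝ) + 1)), p.1 - s • p.2 ∈ Ω := by
      simpa using hp
    have := isCompact_Icc.eventually_forall_of_forall_eventually (x₀ := p)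
      (P := fun (q : Sp d × Sp d) (s : ℝ) => q.1 - s • q.2 ∈ Ω) (fun s hs => by
        have hc : Continuous fun z : (Sp d × Sp d) × ℝ => z.1.1 - z.2 • z.1.2 := by fun_prop
        exact hc.continuousAt.eventually_mem (hΩ.mem_nhds (hp' s hs)))
    filter_upwards [this] with q hq
    simpa using hq
  have : exitTime Ω ⁻¹' Set.Iio t = ({p : Sp d × Sp d | p.2 = 0} ∩ {_p | 0 < t}) ∪
      ({p : Sp d × Sp d | p.2 = 0}ᶜ ∩ ⋃ n : ℕ, {p : Sp d × Sp d |
      ∃ s ∈ Set.Icc (1 / ((n : ℝ) + 1)) (t - 1 / ((n : ℝ) + 1)), p.1 - s • p.2 ∉ Ω}) := by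
    ext p
    by_cases hp : p.2 = 0
    · simp [hp, exitTime_of_eq_zero hp]
    · simp only [Set.mem_preimage, Set.mem_Iio, exitTime_lt_iff hbd hp, Set.mem_union,
        Set.mem_inter_iff, Set.mem_ofPred_eq, hp, false_and, Set.mem_compl_iff, not_false_eq_true,
        true_and, Set.mem_iUnion, false_or]
      constructor
      · rintro ⟨s, h1, h2, h3⟩
        obtain ⟨n, hn⟩ := exists_nat_one_div_lt (lt_min h1 (sub_pos.2 h2))
        exact ⟨n, s, ⟨(hn.trans_le (min_le_left _ _)).le,
          by linarith [hn.trans_le (min_le_right s (t - s))]⟩, h3⟩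
      · rintro ⟨n, s, ⟨h1, h2⟩, h3⟩
        have : 0 < 1 / ((n : ℝ) + 1) := Nat.one_div_pos_of_nat
        exact ⟨s, by linarith, by linarith, h3⟩
  rw [this]
  exact (h0.inter (MeasurableSet.const _)).union (h0.compl.inter (MeasurableSet.iUnion hcl))

/-- The point at which the backward trajectory leaves the domain, with the velocity. -/
def exitPoint (Ω : Set (Sp d)) (p : Sp d × Sp d) : Sp d × Sp d :=
  (p.1 - exitTime Ω p • p.2, p.2)

theorem measurable_exitPoint (hΩ : IsOpen Ω) (hbd : Bornology.IsBounded Ω) :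
    Measurable (exitPoint Ω) :=
  (measurable_fst.sub ((measurable_exitTime hΩ hbd).smul measurable_snd)).prodMk measurable_snd

theorem exitTime_pos (hΩ : IsOpen Ω) (hbd : Bornology.IsBounded Ω) (hb : HasC1Boundary Ω)
    {x v : Sp d} (hx : x ∈ frontier Ω)
    (hv : 0 < inner ℝ v (outerNormal Ω x)) : 0 < exitTime Ω (x, v) := by
  have hv0 : v ≠ 0 := by rintro rfl; simp at hv
  have h1 := eventually_mem_of_inner_outerNormal_neg hΩ hb hx (w := -v)
    (by rw [inner_neg_left]; linarith)
  obtain ⟨ε, hε, h2⟩ := mem_nhdsGT_iff_exists_Ioo_subset.1 h1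
  have hε : 0 < ε := hε
  refine hε.trans_le (le_csInf (exitSet_nonempty hbd hv0) fun s hs => ?_)
  by_contra hc
  push Not at hc
  have := h2 ⟨hs.1, hc⟩
  simp only [Set.mem_ofPred_eq, smul_neg, ← sub_eq_add_neg] at this
  exact hs.2 this

theorem exitPoint_notMem (hΩ : IsOpen Ω) (hbd : Bornology.IsBounded Ω) (hb : HasC1Boundary Ω)
    {x v : Sp d} (hx : x ∈ frontier Ω)
    (hv : 0 < inner ℝ v (outerNormal Ω x)) : x - exitTime Ω (x, v) • v ∉ Ω := by
  have hv0 : v ≠ 0 := by rintro rfl; simp at hv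
  have hpos := exitTime_pos hΩ hbd hb hx hv
  intro hc
  have hcont : Continuous fun s : ℝ => x - s • v := by fun_prop
  obtain ⟨ε, hε, h1⟩ := Metric.mem_nhds_iff.1
    (hcont.continuousAt.preimage_mem_nhds (hΩ.mem_nhds hc))
  obtain ⟨s, hs0, hs1, hs2⟩ := (exitTime_lt_iff (Ω := Ω) (p := (x, v)) hbd hv0).1
    (lt_add_of_pos_right (exitTime Ω (x, v)) hε)
  have hs3 : exitTime Ω (x, v) ≤ s := csInf_le (bddBelow_exitSet (x, v)) ⟨hs0, hs2⟩
  refine hs2 (h1 ?_)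
  rw [Metric.mem_ball, Real.dist_eq, abs_of_nonneg (by linarith)]
  linarith

theorem exitPoint_mem_frontier (hΩ : IsOpen Ω) (hbd : Bornology.IsBounded Ω) (hb : HasC1Boundary Ω)
    {x v : Sp d} (hx : x ∈ frontier Ω)
    (hv : 0 < inner ℝ v (outerNormal Ω x)) : x - exitTime Ω (x, v) • v ∈ frontier Ω := by
  rw [hΩ.frontier_eq]
  refine ⟨?_, exitPoint_notMem hΩ hbd hb hx hv⟩
  have hpos := exitTime_pos hΩ hbd hb hx hv
  have hcont : Continuous fun s : ℝ => x - s • v := by fun_prop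
  refine mem_closure_of_tendsto (hcont.continuousAt.tendsto.mono_left
    (nhdsWithin_le_nhds (s := Set.Iio (exitTime Ω (x, v))))) ?_
  filter_upwards [Ioo_mem_nhdsLT hpos] with s hs
  exact mem_of_lt_exitTime (p := (x, v)) hs.1 hs.2

theorem inner_exitPoint_nonpos (hΩ : IsOpen Ω) (hbd : Bornology.IsBounded Ω) (hb : HasC1Boundary Ω)
    {x v : Sp d} (hx : x ∈ frontier Ω)
    (hv : 0 < inner ℝ v (outerNormal Ω x)) :
    inner ℝ v (outerNormal Ω (x - exitTime Ω (x, v) • v)) ≤ 0 := by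
  have hpos := exitTime_pos hΩ hbd hb hx hv
  refine inner_outerNormal_nonpos_of_eventually_mem hΩ hb
    (exitPoint_mem_frontier hΩ hbd hb hx hv) ?_
  filter_upwards [Ioo_mem_nhdsGT hpos] with s hs
  have := mem_of_lt_exitTime (Ω := Ω) (p := (x, v)) (s := exitTime Ω (x, v) - s)
    (by linarith [hs.2]) (by linarith [hs.1])
  convert this using 1
  module

/-- If two outgoing points shared an exit point with different exit times, the one with the smaller
time would lie on the open segment behind the other, hence in `Ω`, and not on the frontier. -/
theorem injOn_exitPoint (hΩ : IsOpen Ω) (hbd : Bornology.IsBounded Ω) (hb : HasC1Boundary Ω)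
    (v : Sp d) :
    Set.InjOn (fun x => x - exitTime Ω (x, v) • v)
      {x | x ∈ frontier Ω ∧ 0 < inner ℝ v (outerNormal Ω x)} := by
  have key : ∀ x y : Sp d, x ∈ frontier Ω → y ∈ frontier Ω → 0 < inner ℝ v (outerNormal Ω x) →
      x - exitTime Ω (x, v) • v = y - exitTime Ω (y, v) • v →
      exitTime Ω (y, v) ≤ exitTime Ω (x, v) := by
    intro x y hx hy hvx hxy
    by_contra hc
    push Not at hc
    have hpos := exitTime_pos hΩ hbd hb hx hvx
    have h1 := mem_of_lt_exitTime (Ω := Ω) (p := (y, v))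
      (s := exitTime Ω (y, v) - exitTime Ω (x, v)) (by linarith) (by linarith)
    have h2 : y - (exitTime Ω (y, v) - exitTime Ω (x, v)) • v = x := by
      rw [sub_smul, ← sub_add, ← hxy]; abel
    rw [h2] at h1
    rw [hΩ.frontier_eq] at hx
    exact hx.2 h1
  rintro x ⟨hx, hvx⟩ y ⟨hy, hvy⟩ hxy
  have h3 : exitTime Ω (x, v) = exitTime Ω (y, v) :=
    le_antisymm (key y x hy hx hvy hxy.symm) (key x y hx hy hvx hxy)
  simpa [h3] using hxy

theorem exitTime_mul_norm_le (hΩ : IsOpen Ω) (hbd : Bornology.IsBounded Ω) (hb : HasC1Boundary Ω)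
    {x v : Sp d} (hx : x ∈ frontier Ω)
    (hv : 0 < inner ℝ v (outerNormal Ω x)) :
    exitTime Ω (x, v) * ‖v‖ ≤ Metric.diam (closure Ω) := by
  have h1 := Metric.dist_le_diam_of_mem hbd.closure (frontier_subset_closure hx)
    (frontier_subset_closure (exitPoint_mem_frontier hΩ hbd hb hx hv))
  rwa [dist_eq_norm, sub_sub_cancel, norm_smul, Real.norm_eq_abs,
    abs_of_nonneg (exitTime_nonneg _)] at h1

end ExitTime

end

/-! ### The exit map does not increase flux -/

section

variable {d : ℕ} {Ω : Set (Sp d)}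

theorem _root_.ENNReal.le_of_forall_one_lt_ofReal_mul {a b : ℝ≥0∞}
    (h : ∀ t : ℝ, 1 < t → a ≤ ENNReal.ofReal t * b) : a ≤ b := by
  have h1 : Tendsto (fun t : ℝ => ENNReal.ofReal t) (𝓝[>] 1) (𝓝 1) :=
    (ENNReal.continuous_ofReal.tendsto' 1 1 ENNReal.ofReal_one).mono_left nhdsWithin_le_nhds
  have h2 := ENNReal.Tendsto.mul_const (b := b) h1 (Or.inl one_ne_zero)
  rw [one_mul] at h2
  exact ge_of_tendsto h2 (by filter_upwards [self_mem_nhdsWithin] with t ht using h t ht)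

/-- An injection of the outgoing into the incoming part of the boundary along the direction `e`
does not increase the flux. -/
theorem withDensity_inner_preimage_le (hΩ : IsOpen Ω)
    (hbd : Bornology.IsBounded Ω) (hb : HasC1Boundary Ω) {e : Sp d} (he : ‖e‖ = 1)
    {φ : Sp d → Sp d} (hφ : Measurable φ)
    (hinj : Set.InjOn φ {x | x ∈ frontier Ω ∧ 0 < inner ℝ e (outerNormal Ω x)})
    (hmaps : ∀ x ∈ frontier Ω, 0 < inner ℝ e (outerNormal Ω x) →
      φ x ∈ frontier Ω ∧ inner ℝ e (outerNormal Ω (φ x)) ≤ 0 ∧ squeeze e 0 (φ x) = squeeze e 0 x)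
    {B : Set (Sp d)} (hB : MeasurableSet B) :
    ((Measure.euclideanHausdorffMeasure (d - 1) : Measure (Sp d)).withDensity
        fun x => ENNReal.ofReal |inner ℝ e (outerNormal Ω x)|)
      ({x | x ∈ frontier Ω ∧ 0 < inner ℝ e (outerNormal Ω x)} ∩ φ ⁻¹' B) ≤
    ((Measure.euclideanHausdorffMeasure (d - 1) : Measure (Sp d)).withDensity
        fun x => ENNReal.ofReal |inner ℝ e (outerNormal Ω x)|)
      ({x | x ∈ frontier Ω ∧ inner ℝ e (outerNormal Ω x) < 0} ∩ B) := by
  set σ := (Measure.euclideanHausdorffMeasure (d - 1) : Measure (Sp d)) with hσ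
  set ν := σ.withDensity fun x => ENNReal.ofReal |inner ℝ e (outerNormal Ω x)| with hν
  set X := {x | x ∈ frontier Ω ∧ 0 < inner ℝ e (outerNormal Ω x)} with hX
  set Y := {x | x ∈ frontier Ω ∧ inner ℝ e (outerNormal Ω x) < 0} with hY
  have hfr : MeasurableSet (frontier Ω) := isClosed_frontier.measurableSet
  have hen := measurable_inner_outerNormal hΩ hb e
  have hXm : MeasurableSet X := hfr.inter (measurableSet_lt measurable_const hen)
  have hYm : MeasurableSet Y := hfr.inter (measurableSet_lt hen measurable_const)
  refine ENNReal.le_of_forall_one_lt_ofReal_mul fun t ht => ?_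
  obtain ⟨s, hs, hst⟩ := exists_one_lt_pow_le ht 2
  obtain ⟨W, hWm, hWd, hcov, hW⟩ := exists_countable_measurable_partition
    (S := {x | x ∈ frontier Ω ∧ inner ℝ e (outerNormal Ω x) ≠ 0})
    (p := fun U => ∀ A ⊆ frontier Ω ∩ U, MeasurableSet A →
      ν A ≤ ENNReal.ofReal s * σ (squeeze e 0 '' A) ∧
      σ (squeeze e 0 '' A) ≤ ENNReal.ofReal s * ν A)
    (fun U V hUV hV A hA hAm => hV A (hA.trans (by gcongr)) hAm)
    (fun A hA _ => by
      have : A = ∅ := by simpa using hA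
      simp [this])
    (fun x hx => by
      obtain ⟨U, hU, hxU, h⟩ := exists_isOpen_area_estimate hΩ hb hx.1 he hx.2 hs
      refine ⟨U, hU, hxU, fun A hA hAm => ?_⟩
      rw [hν, withDensity_apply _ hAm]
      exact h A hA hAm)
  have hXcov : X ⊆ ⋃ i, W i := fun x hx => hcov ⟨hx.1, hx.2.ne'⟩
  have hYcov : Y ⊆ ⋃ i, W i := fun x hx => hcov ⟨hx.1, hx.2.ne⟩
  -- trajectories that end tangentially
  have hnull : ν (X ∩ φ ⁻¹' Yᶜ) = 0 := by
    have h1 : X ∩ φ ⁻¹' Yᶜ ⊆ ⋃ i, (X ∩ φ ⁻¹' Yᶜ) ∩ W i := by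
      rw [← Set.inter_iUnion]
      exact fun x hx => ⟨hx, hXcov hx.1⟩
    refine measure_mono_null h1 (measure_iUnion_null fun i => ?_)
    have h2 := (hW i ((X ∩ φ ⁻¹' Yᶜ) ∩ W i) (fun x hx => ⟨hx.1.1.1, hx.2⟩)
      ((hXm.inter (hφ hYm.compl)).inter (hWm i))).1
    refine le_antisymm (h2.trans ?_) zero_le
    have h3 : squeeze e 0 '' ((X ∩ φ ⁻¹' Yᶜ) ∩ W i) ⊆
        squeeze e 0 '' {x | x ∈ frontier Ω ∧ inner ℝ e (outerNormal Ω x) = 0} := by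
      rintro _ ⟨x, ⟨⟨hx, hxY⟩, -⟩, rfl⟩
      obtain ⟨h4, h5, h6⟩ := hmaps x hx.1 hx.2
      refine ⟨φ x, ⟨h4, ?_⟩, h6⟩
      by_contra hc
      exact hxY ⟨h4, lt_of_le_of_ne h5 hc⟩
    rw [measure_mono_null h3 (euclideanHausdorffMeasure_projection_glancing hΩ hbd hb he), mul_zero]
  -- Both the starting point and its image are confined to cells of the partition, so the area
  -- estimate applies at each end. The two projections agree, and comparing them costs `s²`.
  set A : ℕ × ℕ → Set (Sp d) := fun q => (X ∩ φ ⁻¹' (Y ∩ B)) ∩ (W q.1 ∩ φ ⁻¹' (W q.2)) with hA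
  have hAm : ∀ q, MeasurableSet (A q) := fun q =>
    (hXm.inter (hφ (hYm.inter hB))).inter ((hWm _).inter (hφ (hWm _)))
  have hAX : ∀ q, A q ⊆ X := fun q x hx => hx.1.1
  have hAd : Pairwise (Function.onFun Disjoint A) := by
    intro q r hqr
    rw [Function.onFun, Set.disjoint_left]
    intro x hxq hxr
    apply hqr
    refine Prod.ext ?_ ?_
    · by_contra hc
      exact Set.disjoint_left.1 (hWd hc) hxq.2.1 hxr.2.1
    · by_contra hc
      exact Set.disjoint_left.1 (hWd hc) hxq.2.2 hxr.2.2
  have hAcov : X ∩ φ ⁻¹' (Y ∩ B) ⊆ ⋃ q, A q := by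
    intro x hx
    obtain ⟨i, hi⟩ := Set.mem_iUnion.1 (hXcov hx.1)
    obtain ⟨j, hj⟩ := Set.mem_iUnion.1 (hYcov hx.2.1)
    exact Set.mem_iUnion.2 ⟨(i, j), hx, hi, hj⟩
  -- The Lusin–Souslin theorem: an injective measurable map between standard Borel spaces has
  -- measurable images.
  have himm : ∀ q, MeasurableSet (φ '' A q) := fun q =>
    (hAm q).image_of_measurable_injOn hφ (hinj.mono (hAX q))
  have himd : Pairwise (Function.onFun Disjoint fun q => φ '' A q) := by
    intro q r hqr
    rw [Function.onFun, Set.disjoint_left]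
    rintro _ ⟨x, hx, rfl⟩ ⟨y, hy, hxy⟩
    obtain rfl := hinj (hAX r hy) (hAX q hx) hxy
    exact Set.disjoint_left.1 (hAd hqr) hx hy
  have hpiece : ∀ q, ν (A q) ≤ ENNReal.ofReal t * ν (φ '' A q) := by
    intro q
    have h1 := (hW q.1 (A q) (fun x hx => ⟨hx.1.1.1, hx.2.1⟩) (hAm q)).1
    have h2 := (hW q.2 (φ '' A q) (by rintro _ ⟨x, hx, rfl⟩; exact ⟨hx.1.2.1.1, hx.2.2⟩)
      (himm q)).2
    have h3 : squeeze e 0 '' (φ '' A q) = squeeze e 0 '' A q := by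
      rw [Set.image_image]
      exact Set.image_congr fun x hx => (hmaps x hx.1.1.1 hx.1.1.2).2.2
    rw [h3] at h2
    calc ν (A q) ≤ ENNReal.ofReal s * (ENNReal.ofReal s * ν (φ '' A q)) := h1.trans (by gcongr)
      _ = ENNReal.ofReal (s ^ 2) * ν (φ '' A q) := by
        rw [← mul_assoc, ← ENNReal.ofReal_mul (by linarith), sq]
      _ ≤ _ := by gcongr
  calc ν (X ∩ φ ⁻¹' B) ≤ ν ((X ∩ φ ⁻¹' (Y ∩ B)) ∪ (X ∩ φ ⁻¹' Yᶜ)) := by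
        refine measure_mono fun x hx => ?_
        by_cases hxY : φ x ∈ Y
        · exact Or.inl ⟨hx.1, hxY, hx.2⟩
        · exact Or.inr ⟨hx.1, hxY⟩
    _ ≤ ν (X ∩ φ ⁻¹' (Y ∩ B)) + ν (X ∩ φ ⁻¹' Yᶜ) := measure_union_le _ _
    _ ≤ ∑' q, ν (A q) := by
        rw [hnull, add_zero]
        exact (measure_mono hAcov).trans (measure_iUnion_le _)
    _ ≤ ∑' q, ENNReal.ofReal t * ν (φ '' A q) := ENNReal.tsum_le_tsum hpiece
    _ = ENNReal.ofReal t * ν (⋃ q, φ '' A q) := by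
        rw [ENNReal.tsum_mul_left, measure_iUnion himd himm]
    _ ≤ ENNReal.ofReal t * ν (Y ∩ B) := by
        gcongr
        refine Set.iUnion_subset fun q => ?_
        rintro _ ⟨x, hx, rfl⟩
        exact hx.1.2

section Flux

variable {m : Measure (Sp d)}

theorem measurable_inner_snd_outerNormal (hΩ : IsOpen Ω) (hb : HasC1Boundary Ω) :
    Measurable fun p : Sp d × Sp d => (inner ℝ p.2 (outerNormal Ω p.1) : ℝ) :=
  measurable_snd.inner ((measurable_outerNormal hΩ hb).comp measurable_fst)

theorem measurableSet_outSet (hΩ : IsOpen Ω) (hb : HasC1Boundary Ω) :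
    MeasurableSet (outSet Ω m) :=
  (isClosed_frontier.measurableSet.preimage measurable_fst).inter
    ((Measure.isClosed_support.measurableSet.preimage measurable_snd).inter
      (measurableSet_lt measurable_const (measurable_inner_snd_outerNormal hΩ hb)))

theorem measurableSet_inSet (hΩ : IsOpen Ω) (hb : HasC1Boundary Ω) :
    MeasurableSet (inSet Ω m) :=
  (isClosed_frontier.measurableSet.preimage measurable_fst).inter
    ((Measure.isClosed_support.measurableSet.preimage measurable_snd).inter
      (measurableSet_lt (measurable_inner_snd_outerNormal hΩ hb) measurable_const))

theorem fluxMeasure_apply [SigmaFinite m] (hΩ : IsOpen Ω) (hbd : Bornology.IsBounded Ω)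
    (hb : HasC1Boundary Ω) {S : Set (Sp d × Sp d)} (hS : MeasurableSet S) :
    fluxMeasure Ω m S = ∫⁻ v, ((surfaceMeasure Ω).withDensity
      fun x => ENNReal.ofReal |inner ℝ v (outerNormal Ω x)|) {x | (x, v) ∈ S} ∂m := by
  have := isFiniteMeasure_surfaceMeasure hΩ hbd hb
  have hg : Measurable fun p : Sp d × Sp d => ENNReal.ofReal |inner ℝ p.2 (outerNormal Ω p.1)| :=
    (measurable_inner_snd_outerNormal hΩ hb).abs.ennreal_ofReal
  rw [fluxMeasure, withDensity_apply _ hS, ← lintegral_indicator hS,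
    lintegral_prod_symm' _ (hg.indicator hS)]
  refine lintegral_congr fun v => ?_
  have hSv : MeasurableSet {x | (x, v) ∈ S} := hS.preimage measurable_prodMk_right
  rw [withDensity_apply _ hSv, ← lintegral_indicator hSv]
  rfl

theorem withDensity_inner_smul {σ : Measure (Sp d)} (hΩ : IsOpen Ω) (hb : HasC1Boundary Ω)
    (v : Sp d) :
    (σ.withDensity fun x => ENNReal.ofReal |inner ℝ v (outerNormal Ω x)|) =
      ENNReal.ofReal ‖v‖ • σ.withDensity
        fun x => ENNReal.ofReal |inner ℝ (‖v‖⁻¹ • v) (outerNormal Ω x)| := by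
  rw [← withDensity_smul _ (measurable_inner_outerNormal hΩ hb _).abs.ennreal_ofReal]
  congr 1
  ext1 x
  rw [Pi.smul_apply, smul_eq_mul, ← ENNReal.ofReal_mul (norm_nonneg _)]
  rcases eq_or_ne v 0 with rfl | hv
  · simp
  · rw [inner_smul_left, RCLike.conj_to_real, abs_mul, abs_inv, abs_norm,
      mul_inv_cancel_left₀ (norm_ne_zero_iff.2 hv)]

/-- Following trajectories backward from the outgoing to the incoming boundary does not increase
the flux measure. -/
theorem map_exitPoint_outMeasure_le [SigmaFinite m] (hΩ : IsOpen Ω) (hbd : Bornology.IsBounded Ω)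
    (hb : HasC1Boundary Ω) : (outMeasure Ω m).map (exitPoint Ω) ≤ inMeasure Ω m := by
  have hφ := measurable_exitPoint hΩ hbd
  have hout := measurableSet_outSet (m := m) hΩ hb
  have hin := measurableSet_inSet (m := m) hΩ hb
  have hfr : MeasurableSet (frontier Ω) := isClosed_frontier.measurableSet
  refine Measure.le_iff.2 fun B hB => ?_
  rw [Measure.map_apply hφ hB, outMeasure, inMeasure, Measure.restrict_apply (hφ hB),
    Measure.restrict_apply hB, fluxMeasure_apply hΩ hbd hb ((hφ hB).inter hout),
    fluxMeasure_apply hΩ hbd hb (hB.inter hin)]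
  refine lintegral_mono fun v => ?_
  by_cases hv : v ∈ m.support
  swap
  · have : {x | (x, v) ∈ exitPoint Ω ⁻¹' B ∩ outSet Ω m} = ∅ := by
      ext x; simp [outSet, hv]
    rw [this, measure_empty]; exact zero_le
  rcases eq_or_ne v 0 with rfl | hv0
  · have : {x | (x, (0 : Sp d)) ∈ exitPoint Ω ⁻¹' B ∩ outSet Ω m} = ∅ := by
      ext x; simp [outSet]
    rw [this, measure_empty]; exact zero_le
  have hvn : 0 < ‖v‖ := norm_pos_iff.2 hv0
  -- The flux density is homogeneous in `v`, and so the inequality for unit directions, applied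
  -- slice by slice, suffices.
  set e := ‖v‖⁻¹ • v with he
  have he1 : ‖e‖ = 1 := by rw [he, norm_smul, norm_inv, norm_norm, inv_mul_cancel₀ hvn.ne']
  have hve : ∀ y : Sp d, inner ℝ e y = ‖v‖⁻¹ * inner ℝ v y := fun y => by
    rw [he, inner_smul_left, RCLike.conj_to_real]
  have hpos : ∀ y : Sp d, 0 < inner ℝ e y ↔ 0 < inner ℝ v y := fun y => by
    rw [hve, mul_pos_iff_of_pos_left (inv_pos.2 hvn)]
  have hneg : ∀ y : Sp d, inner ℝ e y < 0 ↔ inner ℝ v y < 0 := fun y => by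
    rw [hve, ← neg_pos, ← mul_neg, mul_pos_iff_of_pos_left (inv_pos.2 hvn), neg_pos]
  have hvne : v = ‖v‖ • e := by rw [he, smul_inv_smul₀ hvn.ne']
  set φ : Sp d → Sp d := fun x => x - exitTime Ω (x, v) • v with hφdef
  have hφm : Measurable φ := (measurable_fst.comp hφ).comp measurable_prodMk_right
  have hBv : MeasurableSet {x | (x, v) ∈ B} := hB.preimage measurable_prodMk_right
  have key := withDensity_inner_preimage_le hΩ hbd hb he1 hφm
    (by simpa only [hpos] using injOn_exitPoint hΩ hbd hb v)
    (fun x hx hvx => ⟨exitPoint_mem_frontier hΩ hbd hb hx ((hpos _).1 hvx), by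
      rw [← not_lt, hpos, not_lt]
      exact inner_exitPoint_nonpos hΩ hbd hb hx ((hpos _).1 hvx), by
      have : φ x = x + (-(exitTime Ω (x, v) * ‖v‖)) • e := by
        simp only [hφdef]
        rw [neg_smul, mul_smul, ← hvne, sub_eq_add_neg]
      rw [this, squeeze_zero_add_smul he1]⟩) hBv
  have hset1 : {x | (x, v) ∈ exitPoint Ω ⁻¹' B ∩ outSet Ω m} =
      {x | x ∈ frontier Ω ∧ 0 < inner ℝ e (outerNormal Ω x)} ∩ φ ⁻¹' {x | (x, v) ∈ B} := by
    ext x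
    simp only [outSet, exitPoint, hpos, hφdef, hv, Set.mem_inter_iff, Set.mem_preimage,
      Set.mem_ofPred_eq, true_and]
    tauto
  have hset2 : {x | (x, v) ∈ B ∩ inSet Ω m} =
      {x | x ∈ frontier Ω ∧ inner ℝ e (outerNormal Ω x) < 0} ∩ {x | (x, v) ∈ B} := by
    ext x
    simp only [inSet, hneg, hv, Set.mem_inter_iff, Set.mem_ofPred_eq, true_and]
    tauto
  have hrestr : ∀ S ⊆ frontier Ω, MeasurableSet S →
      ((surfaceMeasure Ω).withDensity fun x => ENNReal.ofReal |inner ℝ v (outerNormal Ω x)|) S =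
        ENNReal.ofReal ‖v‖ * ((Measure.euclideanHausdorffMeasure (d - 1) :
          Measure (Sp d)).withDensity fun x => ENNReal.ofReal |inner ℝ e (outerNormal Ω x)|) S := by
    intro S hS hSm
    rw [withDensity_inner_smul hΩ hb, Measure.smul_apply, smul_eq_mul, surfaceMeasure,
      ← restrict_withDensity hfr, Measure.restrict_apply hSm, Set.inter_eq_left.2 hS]
  have hen := measurable_inner_outerNormal hΩ hb e
  rw [hset1, hset2, hrestr _ (fun x hx => hx.1.1), hrestr _ (fun x hx => hx.1.1)]
  · gcongr
  · exact (hfr.inter (measurableSet_lt hen measurable_const)).inter hBv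
  · exact (hfr.inter (measurableSet_lt measurable_const hen)).inter (hφm hBv)

end Flux

end

section

variable {d : ℕ} {Ω : Set (Sp d)} {m : Measure (Sp d)}

/-! ### Existence and contractivity of the transfer operators -/

section Transfer

variable [SigmaFinite m]

theorem quasiMeasurePreserving_exitPoint (h : IsPhaseSpace Ω m) :
    Measure.QuasiMeasurePreserving (exitPoint Ω) (outMeasure Ω m) (inMeasure Ω m) :=
  ⟨measurable_exitPoint h.isOpen h.isBounded,
    (map_exitPoint_outMeasure_le h.isOpen h.isBounded h.c1Boundary).absolutelyContinuous⟩

theorem lintegral_comp_exitPoint_le (h : IsPhaseSpace Ω m) {G : Sp d × Sp d → ℝ≥0∞}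
    (hG : Measurable G) :
    ∫⁻ p, G (exitPoint Ω p) ∂(outMeasure Ω m) ≤ ∫⁻ q, G q ∂(inMeasure Ω m) := by
  rw [← lintegral_map hG (measurable_exitPoint h.isOpen h.isBounded)]
  exact lintegral_mono' (map_exitPoint_outMeasure_le h.isOpen h.isBounded h.c1Boundary) le_rfl

theorem norm_exp_neg_mul_exitTime {lam : ℂ} (p : Sp d × Sp d) :
    ‖Complex.exp (-lam * (exitTime Ω p : ℂ))‖ = Real.exp (-(lam.re * exitTime Ω p)) := by
  rw [Complex.norm_exp]; simp

theorem norm_exp_neg_mul_exitTime_le_one {lam : ℂ} (hlam : 0 ≤ lam.re) (p : Sp d × Sp d) :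
    ‖Complex.exp (-lam * (exitTime Ω p : ℂ))‖ ≤ 1 := by
  rw [norm_exp_neg_mul_exitTime, Real.exp_le_one_iff]
  linarith [mul_nonneg hlam (exitTime_nonneg (Ω := Ω) p)]

theorem eLpNorm_transfer_le (h : IsPhaseSpace Ω m) {lam : ℂ} (hlam : 0 ≤ lam.re)
    (u : L1in Ω m) :
    eLpNorm (fun p => Complex.exp (-lam * (exitTime Ω p : ℂ)) * u (exitPoint Ω p)) 1
      (outMeasure Ω m) ≤ eLpNorm u 1 (inMeasure Ω m) := by
  rw [eLpNorm_one_eq_lintegral_enorm, eLpNorm_one_eq_lintegral_enorm]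
  refine le_trans (lintegral_mono fun p => ?_)
    (lintegral_comp_exitPoint_le h (Lp.stronglyMeasurable u).enorm)
  rw [enorm_mul]
  refine mul_le_of_le_one_left zero_le ?_
  rw [← ofReal_norm, ← ENNReal.ofReal_one]
  exact ENNReal.ofReal_le_ofReal (norm_exp_neg_mul_exitTime_le_one hlam p)

theorem memLp_transfer (h : IsPhaseSpace Ω m) {lam : ℂ} (hlam : 0 ≤ lam.re) (u : L1in Ω m) :
    MemLp (fun p => Complex.exp (-lam * (exitTime Ω p : ℂ)) * u (exitPoint Ω p)) 1
      (outMeasure Ω m) := by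
  refine ⟨?_, (eLpNorm_transfer_le h hlam u).trans_lt (Lp.memLp u).2⟩
  have h1 := measurable_exitTime h.isOpen h.isBounded
  have h2 : Measurable fun p => Complex.exp (-lam * (exitTime Ω p : ℂ)) :=
    Complex.measurable_exp.comp (measurable_const.mul (Complex.measurable_ofReal.comp h1))
  exact (h2.mul ((Lp.stronglyMeasurable u).measurable.comp
    (measurable_exitPoint h.isOpen h.isBounded))).aestronglyMeasurable

/-- The exit map pulls null sets back to null sets, so composition with it is well defined on
classes. The norm bound is the flux inequality together with `|e^{-λ τ₋}| ≤ 1`. -/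
theorem exists_isTransferOp (h : IsPhaseSpace Ω m) {lam : ℂ} (hlam : 0 ≤ lam.re) :
    ∃ T : L1in Ω m →L[ℂ] L1out Ω m, IsTransferOp Ω m lam T := by
  have hq := quasiMeasurePreserving_exitPoint h
  let L : L1in Ω m →ₗ[ℂ] L1out Ω m :=
    { toFun := fun u => (memLp_transfer h hlam u).toLp _
      map_add' := fun u w => by
        rw [← MemLp.toLp_add]
        refine MemLp.toLp_congr _ _ ?_
        filter_upwards [hq.ae (Lp.coeFn_add u w)] with p hp
        simp only [Pi.add_apply] at hp ⊢
        rw [hp]; ring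
      map_smul' := fun c u => by
        rw [RingHom.id_apply, ← MemLp.toLp_const_smul]
        refine MemLp.toLp_congr _ _ ?_
        filter_upwards [hq.ae (Lp.coeFn_smul c u)] with p hp
        simp only [Pi.smul_apply, smul_eq_mul] at hp ⊢
        rw [hp]; ring }
  refine ⟨L.mkContinuous 1 fun u => ?_, fun u => ?_⟩
  · rw [one_mul, Lp.norm_def, Lp.norm_def]
    refine ENNReal.toReal_mono (Lp.memLp u).2.ne ?_
    exact (eLpNorm_congr_ae (MemLp.coeFn_toLp (memLp_transfer h hlam u))).trans_le
      (eLpNorm_transfer_le h hlam u)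
  · exact MemLp.coeFn_toLp (memLp_transfer h hlam u)

theorem isTransferOp_transferOp (h : IsPhaseSpace Ω m) {lam : ℂ} (hlam : 0 ≤ lam.re) :
    IsTransferOp Ω m lam (transferOp Ω m lam) := by
  have hex := exists_isTransferOp h hlam
  rw [transferOp, dif_pos hex]
  exact hex.choose_spec

theorem norm_transferOp_apply_le (h : IsPhaseSpace Ω m) {lam : ℂ} (hlam : 0 ≤ lam.re)
    (u : L1in Ω m) : ‖transferOp Ω m lam u‖ ≤ ‖u‖ := by
  rw [Lp.norm_def, Lp.norm_def]
  refine ENNReal.toReal_mono (Lp.memLp u).2.ne ?_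
  rw [eLpNorm_congr_ae (isTransferOp_transferOp h hlam u)]
  exact eLpNorm_transfer_le h hlam u

theorem MH_apply_ae (h : IsPhaseSpace Ω m) (H : L1out Ω m →L[ℂ] L1in Ω m) {lam : ℂ}
    (hlam : 0 ≤ lam.re) (ψ : L1out Ω m) :
    ∀ᵐ p ∂(outMeasure Ω m), MH Ω m H lam ψ p =
      Complex.exp (-lam * (exitTime Ω p : ℂ)) * H ψ (exitPoint Ω p) :=
  isTransferOp_transferOp h hlam (H ψ)

end Transfer

/-! ### Powers of phases under nonnegative kernels -/

section Phase

/-- The number with the modulus of `z` and `k` times the argument of `z`. -/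
def phasePow (k : ℕ) (z : ℂ) : ℂ := (z / ‖z‖) ^ k * ‖z‖

theorem norm_phasePow (k : ℕ) (z : ℂ) : ‖phasePow k z‖ = ‖z‖ := by
  rcases eq_or_ne z 0 with rfl | hz
  · simp [phasePow]
  · have : (‖z‖ : ℝ) ≠ 0 := norm_ne_zero_iff.2 hz
    simp [phasePow, this]

@[simp] theorem phasePow_zero (z : ℂ) : phasePow 0 z = ‖z‖ := by simp [phasePow]

@[simp] theorem phasePow_one (z : ℂ) : phasePow 1 z = z := by
  rcases eq_or_ne z 0 with rfl | hz
  · simp [phasePow]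
  · rw [phasePow, pow_one, div_mul_cancel₀]
    exact_mod_cast norm_ne_zero_iff.2 hz

theorem measurable_phasePow (k : ℕ) : Measurable (phasePow k) :=
  ((measurable_id.div (Complex.measurable_ofReal.comp measurable_norm)).pow_const k).mul
    (Complex.measurable_ofReal.comp measurable_norm)

theorem norm_one_sub_pow_le {u : ℂ} (hu : ‖u‖ = 1) (k : ℕ) : ‖1 - u ^ k‖ ≤ k * ‖1 - u‖ := by
  induction k with
  | zero => simp
  | succ k ih =>
    have : 1 - u ^ (k + 1) = (1 - u ^ k) + u ^ k * (1 - u) := by ring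
    rw [this]
    refine (norm_add_le _ _).trans ?_
    rw [norm_mul, norm_pow, hu, one_pow, one_mul]
    push_cast
    linarith

theorem norm_one_sub_sq {u : ℂ} (hu : ‖u‖ = 1) : ‖1 - u‖ ^ 2 = 2 * (1 - u.re) := by
  have h1 : u.re * u.re + u.im * u.im = 1 := by
    rw [← Complex.normSq_apply, Complex.normSq_eq_norm_sq, hu, one_pow]
  rw [← Complex.normSq_eq_norm_sq, Complex.normSq_apply]
  simp
  linarith

/-- This is `1 - cos kθ ≤ k² (1 - cos θ)`: it follows from `|1 - u ^ k| ≤ k |1 - u|`, since `|1 -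
u|² = 2 (1 - Re u)` on the unit circle. -/
theorem one_sub_re_pow_le {u : ℂ} (hu : ‖u‖ = 1) (k : ℕ) :
    1 - (u ^ k).re ≤ k ^ 2 * (1 - u.re) := by
  have h1 := norm_one_sub_sq hu
  have h2 := norm_one_sub_sq (u := u ^ k) (by rw [norm_pow, hu, one_pow])
  have h3 : ‖1 - u ^ k‖ ^ 2 ≤ (k * ‖1 - u‖) ^ 2 := by
    gcongr; exact norm_one_sub_pow_le hu k
  rw [mul_pow] at h3
  nlinarith

/-- The inequality is linear in `‖z‖`, `z` and `phasePow k z`, with `c` a free unit constant. It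
therefore survives integration against a nonnegative kernel. -/
theorem norm_sub_re_phasePow_le {c : ℂ} (hc : ‖c‖ = 1) (k : ℕ) (z : ℂ) :
    ‖z‖ - (c ^ k * phasePow k z).re ≤ k ^ 2 * (‖z‖ - (c * z).re) := by
  rcases eq_or_ne z 0 with rfl | hz
  · simp [phasePow]
  have hz0 : (‖z‖ : ℝ) ≠ 0 := norm_ne_zero_iff.2 hz
  set u := c * (z / ‖z‖) with hu
  have hu1 : ‖u‖ = 1 := by simp [hu, hc, hz0]
  have h1 : c ^ k * phasePow k z = u ^ k * (‖z‖ : ℝ) := by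
    rw [phasePow, hu, mul_pow]; ring
  have h2 : c * z = u * (‖z‖ : ℝ) := by
    rw [hu, mul_assoc, div_mul_cancel₀ _ (by exact_mod_cast hz0)]
  rw [h1, h2, Complex.re_mul_ofReal, Complex.re_mul_ofReal]
  have := mul_le_mul_of_nonneg_right (one_sub_re_pow_le hu1 k) (norm_nonneg z)
  linarith

variable {V : Type*} [MeasurableSpace V] {θ : Measure V} {κ : V → ℝ} {h : V → ℂ}

theorem integrable_mul_phasePow_iff (hκ : Measurable κ) (hh : Measurable h) (k : ℕ) :
    Integrable (fun v => (κ v : ℂ) * phasePow k (h v)) θ ↔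
      Integrable (fun v => (κ v : ℂ) * h v) θ := by
  have hκ' : Measurable fun v => (κ v : ℂ) := Complex.measurable_ofReal.comp hκ
  refine integrable_congr' (hκ'.mul ((measurable_phasePow k).comp hh)).aestronglyMeasurable
    (hκ'.mul hh).aestronglyMeasurable (ae_of_all _ fun v => ?_)
  rw [norm_mul, norm_mul, norm_phasePow]

theorem re_integral_mul_phasePow_zero (hκ0 : ∀ᵐ v ∂θ, 0 ≤ κ v) :
    (∫ v, (κ v : ℂ) * phasePow 0 (h v) ∂θ).re = ∫ v, ‖(κ v : ℂ) * h v‖ ∂θ := by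
  have : ∫ v, (κ v : ℂ) * phasePow 0 (h v) ∂θ = ∫ v, ((‖(κ v : ℂ) * h v‖ : ℝ) : ℂ) ∂θ := by
    refine integral_congr_ae ?_
    filter_upwards [hκ0] with v hv
    rw [norm_mul, Complex.norm_real, Real.norm_eq_abs, abs_of_nonneg hv, phasePow_zero]
    push_cast
    rfl
  rw [this, integral_complex_ofReal, Complex.ofReal_re]

theorem norm_integral_mul_phasePow_le (hκ0 : ∀ᵐ v ∂θ, 0 ≤ κ v) (k : ℕ) :
    ‖∫ v, (κ v : ℂ) * phasePow k (h v) ∂θ‖ ≤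
      (∫ v, (κ v : ℂ) * phasePow 0 (h v) ∂θ).re := by
  rw [re_integral_mul_phasePow_zero hκ0]
  refine (norm_integral_le_integral_norm _).trans_eq (integral_congr_ae (ae_of_all _ fun v => ?_))
  simp only [norm_mul, norm_phasePow]

theorem re_integral_sub_phasePow_le (hκ : Measurable κ) (hκ0 : ∀ᵐ v ∂θ, 0 ≤ κ v)
    (hh : Measurable h) {c : ℂ} (hc : ‖c‖ = 1) (k : ℕ) :
    (∫ v, (κ v : ℂ) * phasePow 0 (h v) ∂θ).re -
        (c ^ k * ∫ v, (κ v : ℂ) * phasePow k (h v) ∂θ).re ≤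
      k ^ 2 * ((∫ v, (κ v : ℂ) * phasePow 0 (h v) ∂θ).re -
        (c * ∫ v, (κ v : ℂ) * phasePow 1 (h v) ∂θ).re) := by
  -- All `phasePow j ∘ h` have the same modulus. They are integrable together or not at all, and in
  -- the latter case every integral takes the default value 0.
  by_cases hint : Integrable (fun v => (κ v : ℂ) * h v) θ
  swap
  · have h0 : ∀ j, ∫ v, (κ v : ℂ) * phasePow j (h v) ∂θ = 0 := fun j =>
      integral_undef fun hj => hint ((integrable_mul_phasePow_iff hκ hh j).1 hj)
    rw [h0, h0, h0]
    simp
  have hj : ∀ j, Integrable (fun v => (κ v : ℂ) * phasePow j (h v)) θ := fun j =>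
    (integrable_mul_phasePow_iff hκ hh j).2 hint
  have hre : ∀ (a : ℂ) (j : ℕ), Integrable (fun v => (a * ((κ v : ℂ) * phasePow j (h v))).re) θ :=
    fun a j => ((hj j).const_mul a).re
  have hval : ∀ (a : ℂ) (j : ℕ), (a * ∫ v, (κ v : ℂ) * phasePow j (h v) ∂θ).re =
      ∫ v, (a * ((κ v : ℂ) * phasePow j (h v))).re ∂θ := by
    intro a j
    rw [← integral_const_mul]
    exact (integral_re ((hj j).const_mul a)).symm
  rw [re_integral_mul_phasePow_zero hκ0, hval, hval, ← integral_sub hint.norm (hre _ _),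
    ← integral_sub hint.norm (hre _ _), ← integral_const_mul]
  refine integral_mono_ae (hint.norm.sub (hre _ _)) ((hint.norm.sub (hre _ _)).const_mul _) ?_
  filter_upwards [hκ0] with v hv
  have h1 := mul_le_mul_of_nonneg_left (norm_sub_re_phasePow_le hc k (h v)) hv
  have h2 : (c ^ k * ((κ v : ℂ) * phasePow k (h v))).re = κ v * (c ^ k * phasePow k (h v)).re := by
    rw [mul_left_comm, Complex.re_ofReal_mul]
  have h3 : (c * ((κ v : ℂ) * phasePow 1 (h v))).re = κ v * (c * h v).re := by
    rw [mul_left_comm, Complex.re_ofReal_mul, phasePow_one]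
  simp only [h2, h3, norm_mul, Complex.norm_real, Real.norm_eq_abs, abs_of_nonneg hv]
  linarith

end Phase

/-! ### Phase estimates for diffuse boundary operators -/

section Diffuse

theorem inMeasure_absolutelyContinuous : inMeasure Ω m ≪ (surfaceMeasure Ω).prod m :=
  Measure.restrict_le_self.absolutelyContinuous.trans (withDensity_absolutelyContinuous _ _)

variable [SigmaFinite m]

/-- This carries an identity valid a.e. on `Γ₊` into the kernel integral at a fixed boundary point.
The density `|v · n|` loses nothing, being nonzero on `outSet`. -/
theorem ae_slice_of_ae_outMeasure (h : IsPhaseSpace Ω m) {Q : Sp d × Sp d → Prop}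
    (hQ : ∀ᵐ p ∂(outMeasure Ω m), Q p) :
    ∀ᵐ q ∂(inMeasure Ω m), ∀ᵐ v' ∂(m.restrict {v' | (q.1, v') ∈ outSet Ω m}), Q (q.1, v') := by
  have := isFiniteMeasure_surfaceMeasure h.isOpen h.isBounded h.c1Boundary
  have hout := measurableSet_outSet (m := m) h.isOpen h.c1Boundary
  rw [outMeasure, ae_restrict_iff' hout, fluxMeasure, ae_withDensity_iff
    (measurable_inner_snd_outerNormal h.isOpen h.c1Boundary).abs.ennreal_ofReal] at hQ
  have h1 : ∀ᵐ x ∂(surfaceMeasure Ω), ∀ᵐ v' ∂m, (x, v') ∈ outSet Ω m → Q (x, v') := by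
    filter_upwards [Measure.ae_ae_of_ae_prod hQ] with x hx
    filter_upwards [hx] with v' hv' hmem
    refine hv' ?_ hmem
    simpa using hmem.2.2.ne'
  refine inMeasure_absolutelyContinuous.ae_le ?_
  filter_upwards [Measure.quasiMeasurePreserving_fst.ae h1] with q hq
  exact (ae_restrict_iff' (hout.preimage measurable_prodMk_left)).2 hq

variable {k : Sp d → Sp d → Sp d → ℝ} {H : L1out Ω m →L[ℂ] L1in Ω m}

/-- Pointwise estimates for a diffuse operator applied to functions with the modulus of `f` and
multiples of its phase. -/
theorem IsStochasticDiffuse.phase_estimate (hH : IsStochasticDiffuse Ω m k H)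
    (h : IsPhaseSpace Ω m) (f : L1out Ω m) (F : ℕ → L1out Ω m)
    (hF : ∀ j, ∀ᵐ p ∂(outMeasure Ω m), F j p = phasePow j (f p)) :
    ∀ᵐ q ∂(inMeasure Ω m), ∀ j : ℕ, ‖H (F j) q‖ ≤ (H (F 0) q).re ∧
      ∀ c : ℂ, ‖c‖ = 1 → (H (F 0) q).re - (c ^ j * H (F j) q).re ≤
        j ^ 2 * ((H (F 0) q).re - (c * H (F 1) q).re) := by
  have hout := measurableSet_outSet (m := m) h.isOpen h.c1Boundary
  have hin := measurableSet_inSet (m := m) h.isOpen h.c1Boundary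
  have hmem : ∀ᵐ q ∂(inMeasure Ω m), q ∈ inSet Ω m := ae_restrict_mem hin
  filter_upwards [hmem, ae_all_iff.2 fun j => hH.kernel_form (F j),
    ae_all_iff.2 fun j => ae_slice_of_ae_outMeasure h (hF j)] with q hq hker hsl
  set θ := m.restrict {v' | (q.1, v') ∈ outSet Ω m} with hθ
  set κ : Sp d → ℝ := fun v' => k q.1 q.2 v' * |inner ℝ v' (outerNormal Ω q.1)| with hκdef
  have hκ : Measurable κ := by
    have h1 : Measurable fun v' => k q.1 q.2 v' :=
      hH.measurable.comp (measurable_const.prodMk (measurable_const.prodMk measurable_id))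
    exact h1.mul (measurable_id.inner measurable_const).abs
  have hκ0 : ∀ᵐ v' ∂θ, 0 ≤ κ v' := by
    filter_upwards [ae_restrict_mem (hout.preimage measurable_prodMk_left)] with v' hv'
    exact mul_nonneg (hH.nonneg _ _ _ hq hv') (abs_nonneg _)
  have hh : Measurable fun v' => f (q.1, v') :=
    (Lp.stronglyMeasurable f).measurable.comp measurable_prodMk_left
  have hval : ∀ j, H (F j) q = ∫ v', (κ v' : ℂ) * phasePow j (f (q.1, v')) ∂θ := by
    intro j
    rw [hker j]
    refine integral_congr_ae ?_
    filter_upwards [hsl j] with v' hv'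
    rw [hv']
  intro j
  refine ⟨?_, fun c hc => ?_⟩
  · rw [hval j, hval 0]
    exact norm_integral_mul_phasePow_le hκ0 j
  · rw [hval j, hval 0, hval 1]
    exact re_integral_sub_phasePow_le hκ hκ0 hh hc j

end Diffuse

end

section

/-! ### Unimodular spectrum of contractions -/

section Contraction

variable {E : Type*} [NormedAddCommGroup E] [NormedSpace ℂ E]

/-- A point of modulus one in the spectrum of a contraction is an approximate eigenvalue. -/
theorem exists_approximate_eigenvector [CompleteSpace E] [Nontrivial E] {A : E →L[ℂ] E}
    (hA : ‖A‖ ≤ 1) {z : ℂ} (hz : z ∈ spectrum ℂ A) (hz1 : ‖z‖ = 1) {ε : ℝ} (hε : 0 < ε) :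
    ∃ f : E, ‖f‖ = 1 ∧ ‖A f - z • f‖ ≤ ε := by
  by_contra hcon
  push Not at hcon
  have hlow : ∀ f : E, ε * ‖f‖ ≤ ‖A f - z • f‖ := by
    intro f
    rcases eq_or_ne f 0 with rfl | hf
    · simp
    have hf0 : 0 < ‖f‖ := norm_pos_iff.2 hf
    have h1 := hcon (((‖f‖⁻¹ : ℝ) : ℂ) • f) (by
      rw [norm_smul, Complex.norm_real, norm_inv, norm_norm, inv_mul_cancel₀ hf0.ne'])
    rw [map_smul, smul_comm z, ← smul_sub, norm_smul, Complex.norm_real, norm_inv, norm_norm,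
      lt_inv_mul_iff₀ hf0, mul_comm] at h1
    exact h1.le
  -- The point `w` lies outside the unit disc, at distance `ε / 3` from `z`. The assumed lower bound
  -- on `A - z` bounds the resolvent at `w` by `3 / (2 ε)`. A Neumann series with ratio at most `1 /
  -- 2` then inverts `z - A`.
  set w : ℂ := ((1 + ε / 3 : ℝ) : ℂ) * z with hw
  have hwz : ‖w - z‖ = ε / 3 := by
    have : w - z = ((ε / 3 : ℝ) : ℂ) * z := by rw [hw]; push_cast; ring
    rw [this, norm_mul, hz1, mul_one, Complex.norm_real, Real.norm_eq_abs, abs_of_pos (by linarith)]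
  have hw1 : ‖w‖ = 1 + ε / 3 := by
    rw [hw, norm_mul, hz1, mul_one, Complex.norm_real, Real.norm_eq_abs, abs_of_pos (by linarith)]
  have hwu : IsUnit (algebraMap ℂ (E →L[ℂ] E) w - A) := by
    by_contra hc
    have := spectrum.norm_le_norm_of_mem (𝕜 := ℂ) (a := A) (k := w) (spectrum.mem_iff.2 hc)
    linarith
  obtain ⟨u, hu⟩ := hwu
  set B : E →L[ℂ] E := ↑u⁻¹ with hB
  have huB : ∀ g : E, (algebraMap ℂ (E →L[ℂ] E) w - A) (B g) = g := fun g => by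
    have : (u : E →L[ℂ] E) * B = 1 := u.mul_inv
    rw [← hu, ← mul_apply_eq_comp, this, one_apply_eq_self]
  have happ : ∀ f : E, (algebraMap ℂ (E →L[ℂ] E) w - A) f = w • f - A f := fun f => by
    simp [Algebra.algebraMap_eq_smul_one]
  have hBn : ‖B‖ ≤ 3 / (2 * ε) := by
    refine B.opNorm_le_bound (by positivity) fun g => ?_
    have h1 := hlow (B g)
    have h2 := huB g
    rw [happ] at h2
    have h3 : A (B g) - z • B g = (w - z) • B g - g := by
      have h4 : A (B g) = w • B g - g := by
        rw [eq_sub_iff_add_eq, add_comm, ← eq_sub_iff_add_eq, h2]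
      rw [h4]
      module
    rw [h3] at h1
    have h4 := norm_sub_le ((w - z) • B g) g
    rw [norm_smul, hwz] at h4
    rw [div_mul_eq_mul_div, le_div_iff₀ (by positivity)]
    linarith
  have hsmall : ‖(w - z) • B‖ < 1 := by
    rw [norm_smul, hwz]
    calc ε / 3 * ‖B‖ ≤ ε / 3 * (3 / (2 * ε)) := by gcongr
      _ = 1 / 2 := by field_simp
      _ < 1 := by norm_num
  have hfac : algebraMap ℂ (E →L[ℂ] E) z - A = ↑(u * Units.oneSub _ hsmall) := by
    have h5 : (u : E →L[ℂ] E) * B = 1 := u.mul_inv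
    rw [Units.val_mul, Units.val_oneSub, mul_sub, mul_one, mul_smul_comm, h5, hu,
      Algebra.algebraMap_eq_smul_one, Algebra.algebraMap_eq_smul_one]
    module
  exact spectrum.mem_iff.1 hz (hfac ▸ (u * Units.oneSub _ hsmall).isUnit)

theorem norm_pow_apply_sub_le {A : E →L[ℂ] E} (hA : ‖A‖ ≤ 1) {z : ℂ} (hz1 : ‖z‖ = 1) (f : E)
    (p : ℕ) : ‖(A ^ p) f - z ^ p • f‖ ≤ p * ‖A f - z • f‖ := by
  induction p with
  | zero => simp
  | succ p ih =>
    have h1 : (A ^ (p + 1)) f - z ^ (p + 1) • f =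
        A ((A ^ p) f - z ^ p • f) + z ^ p • (A f - z • f) := by
      rw [pow_succ', mul_apply_eq_comp, map_sub, map_smul, pow_succ]
      module
    rw [h1]
    refine (norm_add_le _ _).trans ?_
    rw [norm_smul, norm_pow, hz1, one_pow, one_mul]
    have h2 := A.le_of_opNorm_le hA ((A ^ p) f - z ^ p • f)
    rw [one_mul] at h2
    refine (add_le_add_left (h2.trans ih) _).trans_eq ?_
    push_cast
    ring

theorem norm_pow_sub_pow_le {A B : E →L[ℂ] E} (hA : ‖A‖ ≤ 1) (hB : ‖B‖ ≤ 1) (p : ℕ) :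
    ‖A ^ p - B ^ p‖ ≤ p * ‖A - B‖ := by
  induction p with
  | zero => simp
  | succ p ih =>
    have h1 : A ^ (p + 1) - B ^ (p + 1) = A * (A ^ p - B ^ p) + (A - B) * B ^ p := by
      rw [pow_succ', pow_succ']; noncomm_ring
    have hBp : ‖B ^ p‖ ≤ 1 := by
      clear ih h1
      induction p with
      | zero => exact ContinuousLinearMap.norm_id_le
      | succ p ih =>
        rw [pow_succ']
        exact (norm_mul_le _ _).trans (mul_le_one₀ hB (norm_nonneg _) ih)
    rw [h1]
    refine (norm_add_le _ _).trans ?_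
    have h2 : ‖A * (A ^ p - B ^ p)‖ ≤ 1 * ‖A ^ p - B ^ p‖ :=
      (norm_mul_le _ _).trans (by gcongr)
    have h3 : ‖(A - B) * B ^ p‖ ≤ ‖A - B‖ * 1 := (norm_mul_le _ _).trans (by gcongr)
    push_cast
    linarith

theorem one_le_norm_pow_of_approximate_eigenvector {A : E →L[ℂ] E} (hA : ‖A‖ ≤ 1) {z : ℂ}
    (hz1 : ‖z‖ = 1) (h : ∀ ε : ℝ, 0 < ε → ∃ f : E, ‖f‖ = 1 ∧ ‖A f - z • f‖ ≤ ε) (p : ℕ) :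
    1 ≤ ‖A ^ p‖ := by
  refine le_of_forall_pos_le_add fun ε hε => ?_
  obtain ⟨f, hf, hAf⟩ := h (ε / (p + 1)) (by positivity)
  have h1 := norm_pow_apply_sub_le hA hz1 f p
  have h2 : (p : ℝ) * ‖A f - z • f‖ ≤ ε := by
    calc (p : ℝ) * ‖A f - z • f‖ ≤ (p + 1) * (ε / (p + 1)) := by gcongr; linarith
      _ = ε := by field_simp
  have h3 := norm_sub_norm_le (z ^ p • f) ((A ^ p) f)
  rw [norm_sub_rev, norm_smul, norm_pow, hz1, hf, one_pow, one_mul] at h3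
  have h4 := (A ^ p).le_opNorm f
  rw [hf, mul_one] at h4
  linarith

end Contraction

/-! ### Pointwise estimates of phase defects -/

section Pointwise

/-- Here `|t - z|² ≤ 2 t (t - Re z)`, and the geometric mean is replaced by a weighted arithmetic
one. The resulting bound is linear and can be integrated; `s` is chosen at the end. -/
theorem norm_ofReal_sub_le {t : ℝ} {z : ℂ} (hz : ‖z‖ ≤ t) {s : ℝ} (hs : 0 < s) :
    ‖(t : ℂ) - z‖ ≤ s * t + (t - z.re) / (2 * s) := by
  have ht : 0 ≤ t := (norm_nonneg z).trans hz
  have hre : 0 ≤ t - z.re := by linarith [z.re_le_norm]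
  refine le_of_sq_le_sq ?_ (by positivity)
  have h1 : ‖(t : ℂ) - z‖ ^ 2 ≤ 2 * t * (t - z.re) := by
    have h2 : ‖z‖ ^ 2 ≤ t ^ 2 := by gcongr
    rw [← Complex.normSq_eq_norm_sq, Complex.normSq_apply] at h2 ⊢
    simp
    nlinarith
  have h3 : (s * t + (t - z.re) / (2 * s)) ^ 2 =
      (s * t - (t - z.re) / (2 * s)) ^ 2 + 2 * t * (t - z.re) := by
    field_simp
    ring
  rw [h3]
  nlinarith [sq_nonneg (s * t - (t - z.re) / (2 * s))]

theorem exists_unit_phase (z : ℂ) : ∃ S : ℂ, ‖S‖ = 1 ∧ ∀ k, phasePow k z = S ^ k * ‖z‖ := by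
  rcases eq_or_ne z 0 with rfl | hz
  · exact ⟨1, by simp, fun k => by simp [phasePow]⟩
  · exact ⟨z / ‖z‖, by simp [hz], fun k => rfl⟩

/-- In use, `e` is the transport phase, `z`, `A₁`, `A` and `a` are values of `f`, `H f`, `H f_k` and
`H |f|`, and `μ` is the approximate eigenvalue. After rotation by the conjugate `b` of `μ` times the
phase of `z`, the quantities `c * A₁` and `c ^ k * A` are both compared with `a`, where `c = b * e`.
-/
theorem norm_phase_defect_le {A₁ A z μ e : ℂ} {a : ℝ} {k : ℕ} (he : ‖e‖ = 1) (hμ : ‖μ‖ = 1)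
    (h1 : ‖A₁‖ ≤ a) (hA : ‖A‖ ≤ a)
    (hc : ∀ c : ℂ, ‖c‖ = 1 → a - (c ^ k * A).re ≤ k ^ 2 * (a - (c * A₁).re)) {s : ℝ}
    (hs : 0 < s) :
    ‖e ^ k * A - μ ^ k * phasePow k z‖ ≤ 2 * s * a +
      (k ^ 2 + 1) / (2 * s) * (a - ‖z‖ + ‖e * A₁ - μ * z‖) + ‖e * A₁ - μ * z‖ := by
  obtain ⟨S, hS, hSk⟩ := exists_unit_phase z
  have hz : z = S * ‖z‖ := by simpa using hSk 1
  have hμS : ‖μ * S‖ = 1 := by rw [norm_mul, hμ, hS, mul_one]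
  set b := (starRingEnd ℂ) (μ * S) with hb
  have hb1 : ‖b‖ = 1 := by rw [hb, Complex.norm_conj, hμS]
  have hbm : b * (μ * S) = 1 := by
    rw [hb, Complex.conj_mul', hμS]; simp
  set c := b * e with hcdef
  have hc1 : ‖c‖ = 1 := by rw [hcdef, norm_mul, hb1, he, mul_one]
  have e1 : ∀ w : ℂ, ‖b ^ k * w‖ = ‖w‖ := fun w => by
    rw [norm_mul, norm_pow, hb1, one_pow, one_mul]
  have e2 : b ^ k * (e ^ k * A - μ ^ k * phasePow k z) = c ^ k * A - ‖z‖ := by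
    rw [hSk k, hcdef, mul_pow]
    have hpow : b ^ k * (μ ^ k * S ^ k) = 1 := by rw [← mul_pow, ← mul_pow, hbm, one_pow]
    linear_combination (-(‖z‖ : ℂ)) * hpow
  have e3 : b * (e * A₁ - μ * z) = c * A₁ - ‖z‖ := by
    have : b * (μ * z) = ‖z‖ := by
      nth_rewrite 1 [hz]
      linear_combination (‖z‖ : ℂ) * hbm
    rw [mul_sub, this, hcdef, mul_assoc]
  have e4 : ‖c * A₁ - ‖z‖‖ = ‖e * A₁ - μ * z‖ := by
    rw [← e3, norm_mul, hb1, one_mul]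
  rw [← e1, e2]
  set D := ‖e * A₁ - μ * z‖
  have n1 : ‖c ^ k * A‖ ≤ a := by rwa [norm_mul, norm_pow, hc1, one_pow, one_mul]
  have n2 : ‖c * A₁‖ ≤ a := by rwa [norm_mul, hc1, one_mul]
  have k1 := norm_ofReal_sub_le n1 hs
  have k2 := norm_ofReal_sub_le n2 hs
  have k3 := hc c hc1
  have k4 : a - (c * A₁).re ≤ a - ‖z‖ + D := by
    have := Complex.abs_re_le_norm (c * A₁ - ‖z‖)
    rw [e4, Complex.sub_re, Complex.ofReal_re] at this
    linarith [neg_le_of_abs_le this]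
  have tri : ‖c ^ k * A - ‖z‖‖ ≤ ‖(a : ℂ) - c ^ k * A‖ + ‖(a : ℂ) - c * A₁‖ + D := by
    have : c ^ k * A - ‖z‖ = -((a : ℂ) - c ^ k * A) + ((a : ℂ) - c * A₁) + (c * A₁ - ‖z‖) := by
      ring
    rw [this]
    refine (norm_add₃_le).trans ?_
    rw [norm_neg, e4]
  have k5 : (a - (c ^ k * A).re) / (2 * s) + (a - (c * A₁).re) / (2 * s) ≤
      (k ^ 2 + 1) / (2 * s) * (a - ‖z‖ + D) := by
    rw [← add_div, div_mul_eq_mul_div]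
    gcongr
    have : ((k : ℝ) ^ 2 + 1) * (a - (c * A₁).re) ≤ (k ^ 2 + 1) * (a - ‖z‖ + D) := by gcongr
    linarith
  linarith

/-- The left side is at most `min (|ζ| τ) 2`, while `1 - e^{-aτ} ≥ aτ / (1 + aτ)`. The term `2 |ζ| /
a` serves `aτ ≤ 1`, and `4` serves `aτ ≥ 1`. With `a = Re λ`, the mass lost to damping controls the
oscillation at every frequency. -/
theorem norm_exp_I_mul_sub_one_le {a τ ζ : ℝ} (ha : 0 < a) (hτ : 0 ≤ τ) :
    ‖Complex.exp (-((ζ : ℂ) * Complex.I) * (τ : ℂ)) - 1‖ ≤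
      (2 * |ζ| / a + 4) * (1 - Real.exp (-(a * τ))) := by
  have hexp : Complex.exp (-((ζ : ℂ) * Complex.I) * (τ : ℂ)) =
      Complex.exp (Complex.I * ((-(ζ * τ) : ℝ) : ℂ)) := by
    congr 1; push_cast; ring
  have h1 : ‖Complex.exp (-((ζ : ℂ) * Complex.I) * (τ : ℂ)) - 1‖ ≤ |ζ| * τ := by
    rw [hexp]
    refine (Real.norm_exp_I_mul_ofReal_sub_one_le).trans_eq ?_
    rw [Real.norm_eq_abs, abs_neg, abs_mul, abs_of_nonneg hτ]
  have h2 : ‖Complex.exp (-((ζ : ℂ) * Complex.I) * (τ : ℂ)) - 1‖ ≤ 2 := by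
    refine (norm_sub_le _ _).trans ?_
    rw [hexp, mul_comm, Complex.norm_exp_ofReal_mul_I]
    norm_num
  have hy : 0 ≤ a * τ := by positivity
  have h3 : a * τ / (1 + a * τ) ≤ 1 - Real.exp (-(a * τ)) := by
    have h4 : Real.exp (-(a * τ)) ≤ 1 / (1 + a * τ) := by
      rw [Real.exp_neg, ← one_div]
      gcongr
      linarith [Real.add_one_le_exp (a * τ)]
    have h5 : a * τ / (1 + a * τ) = 1 - 1 / (1 + a * τ) := by field_simp; ring
    linarith
  refine le_trans ?_ (mul_le_mul_of_nonneg_left h3 (by positivity))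
  rcases le_total (a * τ) 1 with h6 | h6
  · refine h1.trans ?_
    rw [← mul_div_assoc, le_div_iff₀ (by positivity)]
    have h7 : (2 * |ζ| / a + 4) * (a * τ) = 2 * |ζ| * τ + 4 * (a * τ) := by field_simp
    rw [h7]
    nlinarith [mul_nonneg (abs_nonneg ζ) hτ]
  · refine h2.trans ?_
    rw [← mul_div_assoc, le_div_iff₀ (by positivity)]
    have : 0 ≤ 2 * |ζ| / a := by positivity
    nlinarith

end Pointwise

end

section

/-! ### Phase powers in `L¹` -/

section PhaseLp

variable {X : Type*} [MeasurableSpace X] {μ : Measure X}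

theorem memLp_phasePow (k : ℕ) (f : Lp ℂ 1 μ) : MemLp (fun p => phasePow k (f p)) 1 μ :=
  (Lp.memLp f).mono ((measurable_phasePow k).comp
    (Lp.stronglyMeasurable f).measurable).aestronglyMeasurable
    (ae_of_all _ fun p => (norm_phasePow k (f p)).le)

/-- The function with the modulus of `f` and `k` times the phase of `f`, in `L¹`. -/
def phaseLp (k : ℕ) (f : Lp ℂ 1 μ) : Lp ℂ 1 μ := (memLp_phasePow k f).toLp _

theorem coeFn_phaseLp (k : ℕ) (f : Lp ℂ 1 μ) : ∀ᵐ p ∂μ, phaseLp k f p = phasePow k (f p) :=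
  (memLp_phasePow k f).coeFn_toLp

theorem phaseLp_one (f : Lp ℂ 1 μ) : phaseLp 1 f = f :=
  Lp.ext ((coeFn_phaseLp 1 f).mono fun p hp => by rw [hp, phasePow_one])

theorem norm_phaseLp (k : ℕ) (f : Lp ℂ 1 μ) : ‖phaseLp k f‖ = ‖f‖ := by
  rw [L1.norm_eq_integral_norm, L1.norm_eq_integral_norm]
  refine integral_congr_ae ?_
  filter_upwards [coeFn_phaseLp k f] with p hp
  rw [hp, norm_phasePow]

theorem integral_phaseLp_zero (f : Lp ℂ 1 μ) : ∫ p, phaseLp 0 f p ∂μ = (‖f‖ : ℂ) := by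
  rw [L1.norm_eq_integral_norm, ← integral_complex_ofReal]
  refine integral_congr_ae ?_
  filter_upwards [coeFn_phaseLp 0 f] with p hp
  rw [hp, phasePow_zero]

end PhaseLp

/-! ### Transfer of approximate eigenvectors along the imaginary axis -/

variable {d : ℕ} {Ω : Set (Sp d)} {m : Measure (Sp d)} [SigmaFinite m]
  {k : Sp d → Sp d → Sp d → ℝ} {H : L1out Ω m →L[ℂ] L1in Ω m}

/-- Positivity of the kernel gives `|H f| ≤ H |f|` pointwise, and `H |f|` has the mass of `|f|`. -/
theorem IsStochasticDiffuse.norm_apply_le (hH : IsStochasticDiffuse Ω m k H)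
    (h : IsPhaseSpace Ω m) (f : L1out Ω m) : ‖H f‖ ≤ ‖f‖ := by
  have hest := hH.phase_estimate h f (fun j => phaseLp j f) fun j => coeFn_phaseLp j f
  have hint := L1.integrable_coeFn (H (phaseLp 0 f))
  calc ‖H f‖ = ∫ q, ‖H f q‖ ∂(inMeasure Ω m) := L1.norm_eq_integral_norm _
    _ ≤ ∫ q, (H (phaseLp 0 f) q).re ∂(inMeasure Ω m) := by
      refine integral_mono_ae (L1.integrable_coeFn (H f)).norm hint.re ?_
      filter_upwards [hest] with q hq
      have := (hq 1).1
      rwa [phaseLp_one] at this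
    _ = (∫ q, H (phaseLp 0 f) q ∂(inMeasure Ω m)).re := integral_re hint
    _ = ‖f‖ := by
      rw [hH.mass_preserving, integral_phaseLp_zero, Complex.ofReal_re]

theorem norm_MH_le (hH : IsStochasticDiffuse Ω m k H) (h : IsPhaseSpace Ω m) {lam : ℂ}
    (hlam : 0 ≤ lam.re) : ‖MH Ω m H lam‖ ≤ 1 :=
  ContinuousLinearMap.opNorm_le_bound _ zero_le_one fun f => by
    rw [one_mul]
    exact (norm_transferOp_apply_le h hlam _).trans (hH.norm_apply_le h f)

/-- Pointwise description of `M_λ H` on functions with the modulus of `f` and multiples of its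
phase. -/
theorem IsStochasticDiffuse.phase_estimate_exitPoint (hH : IsStochasticDiffuse Ω m k H)
    (h : IsPhaseSpace Ω m) (f : L1out Ω m) :
    ∀ᵐ p ∂(outMeasure Ω m),
      MH Ω m H 0 (phaseLp 0 f) p = H (phaseLp 0 f) (exitPoint Ω p) ∧ ∀ j : ℕ,
      ‖H (phaseLp j f) (exitPoint Ω p)‖ ≤ (MH Ω m H 0 (phaseLp 0 f) p).re ∧
      ∀ c : ℂ, ‖c‖ = 1 →
        (MH Ω m H 0 (phaseLp 0 f) p).re - (c ^ j * H (phaseLp j f) (exitPoint Ω p)).re ≤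
          j ^ 2 * ((MH Ω m H 0 (phaseLp 0 f) p).re - (c * H f (exitPoint Ω p)).re) := by
  have hest := (quasiMeasurePreserving_exitPoint h).ae
    (hH.phase_estimate h f (fun j => phaseLp j f) fun j => coeFn_phaseLp j f)
  filter_upwards [hest, MH_apply_ae h H (lam := 0) le_rfl (phaseLp 0 f)] with p hp hp0
  have h0 : MH Ω m H 0 (phaseLp 0 f) p = H (phaseLp 0 f) (exitPoint Ω p) := by
    rw [hp0]; simp
  rw [phaseLp_one] at hp
  rw [h0]
  exact ⟨rfl, hp⟩

theorem integral_re_MH_zero_le (hH : IsStochasticDiffuse Ω m k H) (h : IsPhaseSpace Ω m)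
    (f : L1out Ω m) : ∫ p, (MH Ω m H 0 (phaseLp 0 f) p).re ∂(outMeasure Ω m) ≤ ‖f‖ := by
  have hint := L1.integrable_coeFn (MH Ω m H 0 (phaseLp 0 f))
  calc ∫ p, (MH Ω m H 0 (phaseLp 0 f) p).re ∂(outMeasure Ω m)
      ≤ ∫ p, ‖MH Ω m H 0 (phaseLp 0 f) p‖ ∂(outMeasure Ω m) :=
        integral_mono hint.re hint.norm fun p => Complex.re_le_norm _
    _ = ‖MH Ω m H 0 (phaseLp 0 f)‖ := (L1.norm_eq_integral_norm _).symm
    _ ≤ 1 * ‖phaseLp 0 f‖ := (MH Ω m H 0).le_of_opNorm_le (norm_MH_le hH h le_rfl) _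
    _ = ‖f‖ := by rw [one_mul, norm_phaseLp]

/-- In use `a = M_0 H |f|`, which has no more mass than `|f|`. Hence `a - |f|` integrates to at most
0, and even a large `β` multiplies only `‖e‖`. -/
theorem norm_le_of_ae_norm_le {X : Type*} [MeasurableSpace X] {μ : Measure X} {G f e : Lp ℂ 1 μ}
    {a : X → ℝ} (ha : Integrable a μ) (hia : ∫ p, a p ∂μ ≤ ‖f‖) {α β : ℝ} (hα : 0 ≤ α)
    (hβ : 0 ≤ β)
    (hpt : ∀ᵐ p ∂μ, ‖G p‖ ≤ α * a p + β * (a p - ‖f p‖ + ‖e p‖) + ‖e p‖) :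
    ‖G‖ ≤ α * ‖f‖ + (β + 1) * ‖e‖ := by
  have hf := (L1.integrable_coeFn f).norm
  have he := (L1.integrable_coeFn e).norm
  have h1 : Integrable (fun p => a p - ‖f p‖) μ := ha.sub hf
  have h2 : Integrable (fun p => a p - ‖f p‖ + ‖e p‖) μ := h1.add he
  have h3 : Integrable (fun p => α * a p + β * (a p - ‖f p‖ + ‖e p‖)) μ :=
    (ha.const_mul α).add (h2.const_mul β)
  calc ‖G‖ = ∫ p, ‖G p‖ ∂μ := L1.norm_eq_integral_norm _
    _ ≤ ∫ p, (α * a p + β * (a p - ‖f p‖ + ‖e p‖) + ‖e p‖) ∂μ :=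
        integral_mono_ae (L1.integrable_coeFn G).norm (h3.add he) hpt
    _ = α * (∫ p, a p ∂μ) + β * ((∫ p, a p ∂μ) - ‖f‖ + ‖e‖) + ‖e‖ := by
        rw [integral_add h3 he, integral_add (ha.const_mul α) (h2.const_mul β),
          integral_const_mul, integral_const_mul, integral_add h1 he, integral_sub ha hf,
          ← L1.norm_eq_integral_norm, ← L1.norm_eq_integral_norm]
    _ ≤ α * ‖f‖ + β * (‖f‖ - ‖f‖ + ‖e‖) + ‖e‖ := by gcongr
    _ = _ := by ring

theorem coeFn_sub_smul {X : Type*} [MeasurableSpace X] {μ : Measure X} (g f : Lp ℂ 1 μ) (z : ℂ) :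
    ∀ᵐ p ∂μ, (g - z • f : Lp ℂ 1 μ) p = g p - z * f p := by
  filter_upwards [Lp.coeFn_sub g (z • f), Lp.coeFn_smul z f] with p h1 h2
  rw [h1, Pi.sub_apply, h2, Pi.smul_apply, smul_eq_mul]

/-- An approximate eigenvector of `M_{iη} H` yields one of `M_{ijη} H` for every `j`. -/
theorem norm_MH_phaseLp_sub_le (hH : IsStochasticDiffuse Ω m k H) (h : IsPhaseSpace Ω m) (η : ℝ)
    {z : ℂ} (hz : ‖z‖ = 1) (f : L1out Ω m) (j : ℕ) {s : ℝ} (hs : 0 < s) :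
    ‖MH Ω m H (((j * η : ℝ) : ℂ) * Complex.I) (phaseLp j f) - z ^ j • phaseLp j f‖ ≤
      2 * s * ‖f‖ + ((j ^ 2 + 1) / (2 * s) + 1) *
        ‖MH Ω m H ((η : ℂ) * Complex.I) f - z • f‖ := by
  set T := MH Ω m H ((η : ℂ) * Complex.I) with hT
  set G := MH Ω m H (((j * η : ℝ) : ℂ) * Complex.I) (phaseLp j f) - z ^ j • phaseLp j f with hG
  set a : Sp d × Sp d → ℝ := fun p => (MH Ω m H 0 (phaseLp 0 f) p).re with ha
  have haint : Integrable a (outMeasure Ω m) :=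
    (L1.integrable_coeFn (MH Ω m H 0 (phaseLp 0 f))).re
  have hpt : ∀ᵐ p ∂(outMeasure Ω m), ‖G p‖ ≤ 2 * s * a p +
      (j ^ 2 + 1) / (2 * s) * (a p - ‖f p‖ + ‖(T f - z • f : L1out Ω m) p‖) +
        ‖(T f - z • f : L1out Ω m) p‖ := by
    filter_upwards [coeFn_sub_smul (MH Ω m H (((j * η : ℝ) : ℂ) * Complex.I) (phaseLp j f))
      (phaseLp j f) (z ^ j), coeFn_sub_smul (T f) f z, coeFn_phaseLp j f,
      MH_apply_ae h H (lam := ((j * η : ℝ) : ℂ) * Complex.I) (by simp) (phaseLp j f),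
      MH_apply_ae h H (lam := (η : ℂ) * Complex.I) (by simp) f,
      hH.phase_estimate_exitPoint h f] with p h1 h2 h3 h4 h5 h6
    -- Multiplying the frequency by `j` raises the transport phase to the power `j`, just as
    -- `phaseLp j` does with the phase of `f`.
    have hexp : Complex.exp (-(((j * η : ℝ) : ℂ) * Complex.I) * (exitTime Ω p : ℂ)) =
        Complex.exp (-((η : ℂ) * Complex.I) * (exitTime Ω p : ℂ)) ^ j := by
      rw [← Complex.exp_nat_mul]
      congr 1
      push_cast
      ring
    have he : ‖Complex.exp (-((η : ℂ) * Complex.I) * (exitTime Ω p : ℂ))‖ = 1 := by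
      rw [norm_exp_neg_mul_exitTime]; simp
    have hA1 := (h6.2 1).1
    rw [phaseLp_one] at hA1
    rw [h1, h2, h3, h4, h5, hexp]
    exact norm_phase_defect_le he hz hA1 (h6.2 j).1 (h6.2 j).2 hs
  exact norm_le_of_ae_norm_le haint (integral_re_MH_zero_le hH h f) (by positivity)
    (by positivity) hpt

/-- An approximate eigenvector of `M_λ H` with `Re λ > 0` yields an almost invariant function of
all `M_{iζ} H`. -/
theorem norm_MH_imaginary_sub_le (hH : IsStochasticDiffuse Ω m k H) (h : IsPhaseSpace Ω m)
    {lam : ℂ} (hlam : 0 < lam.re) {z : ℂ} (hz : ‖z‖ = 1) (f : L1out Ω m) (ζ : ℝ) :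
    ‖MH Ω m H ((ζ : ℂ) * Complex.I) (phaseLp 0 f) - (1 : ℂ) • phaseLp 0 f‖ ≤
      (2 * |ζ| / lam.re + 6) * ‖MH Ω m H lam f - z • f‖ := by
  set T := MH Ω m H lam with hT
  set G := MH Ω m H ((ζ : ℂ) * Complex.I) (phaseLp 0 f) - (1 : ℂ) • phaseLp 0 f with hG
  set a : Sp d × Sp d → ℝ := fun p => (MH Ω m H 0 (phaseLp 0 f) p).re with ha
  have haint : Integrable a (outMeasure Ω m) :=
    (L1.integrable_coeFn (MH Ω m H 0 (phaseLp 0 f))).re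
  set C : ℝ := 2 * |ζ| / lam.re + 4 with hC
  have hC0 : 0 ≤ C := by positivity
  have hpt : ∀ᵐ p ∂(outMeasure Ω m), ‖G p‖ ≤
      (C + 1) * (a p - ‖f p‖ + ‖(T f - z • f : L1out Ω m) p‖) +
        ‖(T f - z • f : L1out Ω m) p‖ := by
    filter_upwards [coeFn_sub_smul (MH Ω m H ((ζ : ℂ) * Complex.I) (phaseLp 0 f))
      (phaseLp 0 f) 1, coeFn_sub_smul (T f) f z, coeFn_phaseLp 0 f,
      MH_apply_ae h H (lam := (ζ : ℂ) * Complex.I) (by simp) (phaseLp 0 f),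
      MH_apply_ae h H hlam.le f,
      hH.phase_estimate_exitPoint h f] with p h1 h2 h3 h4 h5 h6
    have hA1 := (h6.2 1).1
    have hA0 := (h6.2 0).1
    rw [phaseLp_one] at hA1
    rw [← h6.1] at h4 hA0
    -- A complex number whose modulus does not exceed its real part is real.
    have hreal : MH Ω m H 0 (phaseLp 0 f) p = (a p : ℂ) := by
      have hnn : (MH Ω m H 0 (phaseLp 0 f) p).re = ‖MH Ω m H 0 (phaseLp 0 f) p‖ :=
        le_antisymm (Complex.re_le_norm _) hA0
      have him := Complex.abs_re_eq_norm.1 (by rw [hnn, abs_norm])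
      exact Complex.ext rfl (by rw [him, Complex.ofReal_im])
    have ha0 : 0 ≤ a p := (norm_nonneg _).trans hA1
    have hTf : ‖T f p‖ ≤ Real.exp (-(lam.re * exitTime Ω p)) * a p := by
      rw [hT, h5, norm_mul, norm_exp_neg_mul_exitTime]
      gcongr
    have hex := norm_exp_I_mul_sub_one_le (ζ := ζ) hlam (exitTime_nonneg (Ω := Ω) p)
    have hexp1 : Real.exp (-(lam.re * exitTime Ω p)) ≤ 1 := by
      rw [Real.exp_le_one_iff]
      linarith [mul_nonneg hlam.le (exitTime_nonneg (Ω := Ω) p)]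
    have hdiff : |‖T f p‖ - ‖f p‖| ≤ ‖(T f - z • f : L1out Ω m) p‖ := by
      rw [h2]
      have := abs_norm_sub_norm_le (T f p) (z * f p)
      rwa [norm_mul, hz, one_mul] at this
    have hdiff' := abs_le.1 hdiff
    rw [h1, h3, h4, hreal, phasePow_zero, one_mul]
    set E := Complex.exp (-((ζ : ℂ) * Complex.I) * (exitTime Ω p : ℂ)) with hE
    have hsplit : E * (a p : ℂ) - (‖f p‖ : ℂ) =
        (E - 1) * (a p : ℂ) + ((a p - ‖f p‖ : ℝ) : ℂ) := by push_cast; ring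
    -- Since `|T f| ≤ e^{-Re λ τ₋} a`, the damping loss `(1 - e^{-Re λ τ₋}) a` is at most `a - |T
    -- f|`, which the eigenvector defect controls after integration.
    have hfirst : ‖(E - 1) * (a p : ℂ)‖ ≤ C * (a p - ‖T f p‖) := by
      rw [norm_mul, Complex.norm_real, Real.norm_eq_abs, abs_of_nonneg ha0]
      calc ‖E - 1‖ * a p ≤ C * (1 - Real.exp (-(lam.re * exitTime Ω p))) * a p := by gcongr
        _ = C * (a p - Real.exp (-(lam.re * exitTime Ω p)) * a p) := by ring
        _ ≤ C * (a p - ‖T f p‖) := by gcongr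
    have hTa : ‖T f p‖ ≤ a p := hTf.trans (mul_le_of_le_one_left ha0 hexp1)
    have hsecond : |a p - ‖f p‖| ≤ (a p - ‖T f p‖) + ‖(T f - z • f : L1out Ω m) p‖ := by
      rw [abs_le]; constructor <;> linarith [hdiff'.1, hdiff'.2]
    rw [hsplit]
    refine (norm_add_le _ _).trans ?_
    rw [Complex.norm_real, Real.norm_eq_abs]
    have hlast : a p - ‖T f p‖ ≤ a p - ‖f p‖ + ‖(T f - z • f : L1out Ω m) p‖ := by
      linarith [hdiff'.1]
    have := mul_le_mul_of_nonneg_left hlast (by linarith : 0 ≤ C + 1)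
    linarith
  have := norm_le_of_ae_norm_le (α := 0) (β := C + 1) haint (integral_re_MH_zero_le hH h f) le_rfl
    (by linarith) (by simpa only [zero_mul, zero_add] using hpt)
  rw [hC] at this
  linarith

/-- `ζ ↦ M_{iζ} H` is Lipschitz in operator norm if `H` gains integrability at small velocities. -/
theorem exists_lipschitz_MH (h : IsPhaseSpace Ω m) {n : ℕ}
    (hgain : GainsIntegrability Ω m H (n + 1)) : ∃ C : ℝ, 0 ≤ C ∧ ∀ ζ ξ : ℝ,
    ‖MH Ω m H ((ζ : ℂ) * Complex.I) - MH Ω m H ((ξ : ℂ) * Complex.I)‖ ≤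
      C * |ζ - ξ| := by
  obtain ⟨K, hK⟩ := hgain
  set D := Metric.diam (closure Ω) with hD
  have hD0 : 0 ≤ D := Metric.diam_nonneg
  refine ⟨D * K, by positivity, fun ζ ξ => ContinuousLinearMap.opNorm_le_bound _ (by positivity)
    fun ψ => ?_⟩
  set w : Sp d × Sp d → ℝ≥0∞ := fun q => ENNReal.ofReal (max 1 (‖q.2‖⁻¹ ^ (n + 1))) * ‖H ψ q‖ₑ
    with hw
  have hwm : Measurable w := by
    refine Measurable.mul ?_ (Lp.stronglyMeasurable (H ψ)).enorm
    exact (measurable_const.max ((measurable_snd.norm.inv).pow_const _)).ennreal_ofReal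
  have hmem : ∀ᵐ p ∂(outMeasure Ω m), p ∈ outSet Ω m :=
    ae_restrict_mem (measurableSet_outSet h.isOpen h.c1Boundary)
  have hpt : ∀ᵐ p ∂(outMeasure Ω m),
      ‖((MH Ω m H ((ζ : ℂ) * Complex.I) - MH Ω m H ((ξ : ℂ) * Complex.I)) ψ : L1out Ω m) p‖ₑ ≤
        ENNReal.ofReal (D * |ζ - ξ|) * w (exitPoint Ω p) := by
    filter_upwards [hmem, Lp.coeFn_sub (MH Ω m H ((ζ : ℂ) * Complex.I) ψ)
      (MH Ω m H ((ξ : ℂ) * Complex.I) ψ),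
      MH_apply_ae h H (lam := (ζ : ℂ) * Complex.I) (by simp) ψ,
      MH_apply_ae h H (lam := (ξ : ℂ) * Complex.I) (by simp) ψ] with p hp h1 h2 h3
    rw [sub_apply, h1, Pi.sub_apply, h2, h3, ← sub_mul, enorm_mul, hw]
    simp only
    rw [← mul_assoc, ← ENNReal.ofReal_mul (by positivity), ← ofReal_norm (Complex.exp _ - _)]
    gcongr
    have hτ := exitTime_mul_norm_le h.isOpen h.isBounded h.c1Boundary hp.1 hp.2.2
    have hv : 0 < ‖p.2‖ := norm_pos_iff.2 fun hc => by
      have := hp.2.2; rw [hc, inner_zero_left] at this; exact lt_irrefl _ this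
    have hτ' : exitTime Ω p ≤ D * ‖p.2‖⁻¹ := by
      rw [← div_eq_mul_inv, le_div_iff₀ hv]; exact hτ
    -- The Lipschitz constant of the exponential is `τ₋ ≤ D / |v|`, unbounded at small speeds. One
    -- power of `|v|⁻¹` from the weight absorbs it.
    have hmax : ‖p.2‖⁻¹ ≤ max 1 (‖p.2‖⁻¹ ^ (n + 1)) := by
      rcases le_total ‖p.2‖⁻¹ 1 with h4 | h4
      · exact h4.trans (le_max_left _ _)
      · exact (le_self_pow₀ h4 (by omega)).trans (le_max_right _ _)
    have hexp : Complex.exp (-((ζ : ℂ) * Complex.I) * (exitTime Ω p : ℂ)) -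
        Complex.exp (-((ξ : ℂ) * Complex.I) * (exitTime Ω p : ℂ)) =
        Complex.exp (-((ξ : ℂ) * Complex.I) * (exitTime Ω p : ℂ)) *
          (Complex.exp (Complex.I * ((-((ζ - ξ) * exitTime Ω p) : ℝ) : ℂ)) - 1) := by
      rw [mul_sub, mul_one, ← Complex.exp_add]
      congr 2
      push_cast
      ring
    rw [hexp, norm_mul]
    calc _ ≤ 1 * ‖-((ζ - ξ) * exitTime Ω p)‖ := by
          gcongr
          · exact norm_exp_neg_mul_exitTime_le_one (by simp) p
          · exact Real.norm_exp_I_mul_ofReal_sub_one_le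
      _ = |ζ - ξ| * exitTime Ω p := by
          rw [one_mul, norm_neg, norm_mul, Real.norm_eq_abs, Real.norm_eq_abs,
            abs_of_nonneg (exitTime_nonneg p)]
      _ ≤ |ζ - ξ| * (D * max 1 (‖p.2‖⁻¹ ^ (n + 1))) := by
          gcongr
          exact hτ'.trans (by gcongr)
      _ = _ := by simp only [exitPoint]; ring
  have hlint : ‖(MH Ω m H ((ζ : ℂ) * Complex.I) - MH Ω m H ((ξ : ℂ) * Complex.I)) ψ‖ₑ ≤
      ENNReal.ofReal (D * |ζ - ξ|) * (K * ‖ψ‖ₑ) := by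
    rw [Lp.enorm_def, eLpNorm_one_eq_lintegral_enorm]
    refine (lintegral_mono_ae hpt).trans ?_
    rw [lintegral_const_mul' _ _ ENNReal.ofReal_ne_top]
    gcongr
    exact (lintegral_comp_exitPoint_le h hwm).trans (hK ψ)
  have hfin : ENNReal.ofReal (D * |ζ - ξ|) * (K * ‖ψ‖ₑ) =
      ENNReal.ofReal (D * K * |ζ - ξ| * ‖ψ‖) := by
    rw [← ofReal_norm, ← ENNReal.ofReal_coe_nnreal, ← ENNReal.ofReal_mul (by positivity),
      ← ENNReal.ofReal_mul (by positivity)]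
    congr 1
    ring
  rw [hfin, ← ofReal_norm] at hlint
  exact (ENNReal.ofReal_le_ofReal_iff (by positivity)).1 hlint

end

/-! ### Contradiction with integrability on the imaginary axis -/

section

variable {d : ℕ} {Ω : Set (Sp d)} {m : Measure (Sp d)} [SigmaFinite m]
  {k : Sp d → Sp d → Sp d → ℝ} {H : L1out Ω m →L[ℂ] L1in Ω m}

theorem volume_iUnion_ball_nat_mul {η δ : ℝ} (hδ : 0 < δ) (h : 2 * δ ≤ |η|) :
    volume (⋃ j : ℕ, Metric.ball ((j : ℝ) * η) δ) = ∞ := by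
  rw [measure_iUnion]
  · simp only [Real.volume_ball]
    refine ENNReal.tsum_const_eq_top_of_ne_zero ?_
    simpa using hδ
  · intro i j hij
    refine Metric.ball_disjoint_ball ?_
    rw [Real.dist_eq, ← sub_mul, abs_mul]
    have h1 : (1 : ℝ) ≤ |(i : ℝ) - j| := by
      have : (1 : ℤ) ≤ |(i : ℤ) - j| := Int.one_le_abs (sub_ne_zero.2 (by exact_mod_cast hij))
      exact_mod_cast this
    nlinarith [abs_nonneg η]
  · exact fun _ => Metric.isOpen_ball.measurableSet

theorem one_le_norm_MH_pow_of_re_pos (hH : IsStochasticDiffuse Ω m k H) (h : IsPhaseSpace Ω m)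
    {lam : ℂ} (hlam : 0 < lam.re) {z : ℂ} (hz : ‖z‖ = 1)
    (happ : ∀ ε : ℝ, 0 < ε → ∃ f : L1out Ω m, ‖f‖ = 1 ∧ ‖MH Ω m H lam f - z • f‖ ≤ ε)
    (ζ : ℝ) (p : ℕ) : 1 ≤ ‖MH Ω m H ((ζ : ℂ) * Complex.I) ^ p‖ := by
  refine one_le_norm_pow_of_approximate_eigenvector (norm_MH_le hH h (by simp)) norm_one
    (fun ε hε => ?_) p
  have hC : 0 < 2 * |ζ| / lam.re + 6 := by positivity
  obtain ⟨f, hf, hfe⟩ := happ (ε / (2 * |ζ| / lam.re + 6)) (div_pos hε hC)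
  refine ⟨phaseLp 0 f, by rw [norm_phaseLp, hf], ?_⟩
  refine (norm_MH_imaginary_sub_le hH h hlam hz f ζ).trans ?_
  rwa [mul_comm, ← le_div_iff₀ hC]

theorem one_le_norm_MH_pow_of_imaginary (hH : IsStochasticDiffuse Ω m k H) (h : IsPhaseSpace Ω m)
    {η : ℝ} {z : ℂ} (hz : ‖z‖ = 1)
    (happ : ∀ ε : ℝ, 0 < ε →
      ∃ f : L1out Ω m, ‖f‖ = 1 ∧ ‖MH Ω m H ((η : ℂ) * Complex.I) f - z • f‖ ≤ ε)
    (j p : ℕ) : 1 ≤ ‖MH Ω m H (((j * η : ℝ) : ℂ) * Complex.I) ^ p‖ := by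
  refine one_le_norm_pow_of_approximate_eigenvector (z := z ^ j) (norm_MH_le hH h (by simp))
    (by rw [norm_pow, hz, one_pow]) (fun ε hε => ?_) p
  -- This makes `2 s ‖f‖ = ε / 2`. The vector `f` is chosen after `s`, since its required accuracy
  -- depends on `1 / s`.
  set s : ℝ := ε / 4 with hs
  have hs0 : 0 < s := by positivity
  set C : ℝ := ((j : ℝ) ^ 2 + 1) / (2 * s) + 1 with hC
  have hC0 : 0 < C := by positivity
  obtain ⟨f, hf, hfe⟩ := happ (ε / 2 / C) (by positivity)
  refine ⟨phaseLp j f, by rw [norm_phaseLp, hf], ?_⟩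
  refine (norm_MH_phaseLp_sub_le hH h η hz f j hs0).trans ?_
  rw [hf, ← hC]
  have : C * ‖MH Ω m H ((η : ℂ) * Complex.I) f - z • f‖ ≤ ε / 2 := by
    rwa [mul_comm, ← le_div_iff₀ hC0]
  rw [hs]
  linarith

theorem spectralRadius_MH_lt_one (h : IsPhaseSpace Ω m) (hH : IsAdmissibleBoundaryOp Ω m k H)
    {lam : ℂ} (hlam : lam ≠ 0) (hre : 0 ≤ lam.re) : spectralRadius ℂ (MH Ω m H lam) < 1 := by
  rcases subsingleton_or_nontrivial (L1out Ω m) with hsub | hnt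
  · rw [spectrum.SpectralRadius.of_subsingleton]
    exact zero_lt_one
  by_contra hcon
  push Not at hcon
  have hdiff := hH.diffuse
  have hA := norm_MH_le hdiff h hre
  -- The spectral radius is attained because the spectrum is compact and nonempty.
  obtain ⟨z, hzs, hzr⟩ := spectrum.exists_nnnorm_eq_spectralRadius (MH Ω m H lam)
  have hz1 : ‖z‖ = 1 := by
    refine le_antisymm ((spectrum.norm_le_norm_of_mem hzs).trans hA) ?_
    rw [← hzr] at hcon
    exact_mod_cast hcon
  have happ : ∀ ε : ℝ, 0 < ε →
      ∃ f : L1out Ω m, ‖f‖ = 1 ∧ ‖MH Ω m H lam f - z • f‖ ≤ ε := fun ε hε =>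
    exists_approximate_eigenvector hA hzs hz1 hε
  obtain ⟨p, C, hpC⟩ := hH.power_integrable
  have hint : ∫⁻ ζ : ℝ, ‖MH Ω m H ((ζ : ℂ) * Complex.I) ^ p‖ₑ ≤ C := by
    simpa using hpC 0 le_rfl
  -- the set of frequencies at which the norm is at least `1 / 2` has infinite measure
  have hbig : ∀ S : Set ℝ, MeasurableSet S → volume S = ∞ →
      ¬ ∀ ζ ∈ S, (1 / 2 : ℝ) ≤ ‖MH Ω m H ((ζ : ℂ) * Complex.I) ^ p‖ := by
    intro S hSm hS hlow
    have h1 : ∫⁻ _ζ in S, ENNReal.ofReal (1 / 2) ≤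
        ∫⁻ ζ : ℝ, ‖MH Ω m H ((ζ : ℂ) * Complex.I) ^ p‖ₑ := by
      refine (setLIntegral_mono' hSm fun ζ hζ => ?_).trans (setLIntegral_le_lintegral S _)
      rw [← ofReal_norm]
      exact ENNReal.ofReal_le_ofReal (hlow ζ hζ)
    rw [setLIntegral_const, hS, ENNReal.mul_top (by simp)] at h1
    exact absurd (h1.trans hint) (by simp)
  rcases hre.eq_or_lt with hre0 | hpos
  swap
  · refine hbig Set.univ MeasurableSet.univ Real.volume_univ fun ζ _ => ?_
    linarith [one_le_norm_MH_pow_of_re_pos hdiff h hpos hz1 happ ζ p]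
  set η := lam.im with hη
  have hlamη : lam = (η : ℂ) * Complex.I := Complex.ext (by simp [← hre0]) (by simp [hη])
  have hη0 : η ≠ 0 := fun hc => hlam (by rw [hlamη, hc]; simp)
  rw [hlamη] at happ
  obtain ⟨n, hgain⟩ := hH.gain
  obtain ⟨L, hL0, hL⟩ := exists_lipschitz_MH h hgain
  -- The first bound keeps the balls around the points `jη` disjoint. The second gives `p L δ ≤ 1 /
  -- 2`, so the norm drops by at most `1 / 2` within a ball; the `+ 1` guards against `p L = 0`.
  set δ : ℝ := min (|η| / 2) (1 / (2 * (p * L + 1))) with hδ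
  have hδ0 : 0 < δ := lt_min (by positivity) (by positivity)
  refine hbig (⋃ j : ℕ, Metric.ball ((j : ℝ) * η) δ)
    (MeasurableSet.iUnion fun _ => Metric.isOpen_ball.measurableSet)
    (volume_iUnion_ball_nat_mul hδ0 (by linarith [min_le_left (|η| / 2) (1 / (2 * (p * L + 1)))]))
    fun ζ hζ => ?_
  obtain ⟨j, hj⟩ := Set.mem_iUnion.1 hζ
  rw [Metric.mem_ball, Real.dist_eq] at hj
  have h1 := one_le_norm_MH_pow_of_imaginary hdiff h hz1 happ j p
  have h2 := norm_pow_sub_pow_le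
    (norm_MH_le (lam := ((j * η : ℝ) : ℂ) * Complex.I) hdiff h (by simp))
    (norm_MH_le (lam := (ζ : ℂ) * Complex.I) hdiff h (by simp)) p
  have h3 := hL (j * η) ζ
  have h4 := norm_sub_norm_le (MH Ω m H (((j * η : ℝ) : ℂ) * Complex.I) ^ p)
    (MH Ω m H ((ζ : ℂ) * Complex.I) ^ p)
  have h5 : (p : ℝ) * (L * |(j : ℝ) * η - ζ|) ≤ 1 / 2 := by
    rw [abs_sub_comm]
    have h6 : |ζ - j * η| ≤ 1 / (2 * (p * L + 1)) := hj.le.trans (min_le_right _ _)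
    calc (p : ℝ) * (L * |ζ - j * η|) ≤ p * (L * (1 / (2 * (p * L + 1)))) := by gcongr
      _ ≤ 1 / 2 := by
        rw [← mul_assoc, mul_one_div, div_le_div_iff₀ (by positivity) (by positivity)]
        linarith
  have h7 : (p : ℝ) * ‖MH Ω m H (((j * η : ℝ) : ℂ) * Complex.I) - MH Ω m H ((ζ : ℂ) * Complex.I)‖ ≤
      p * (L * |(j : ℝ) * η - ζ|) := by gcongr
  linarith

end

end Kinetic

end

theorem proposition4p2 {d : ℕ} (hd : 2 ≤ d)
    (Ω : Set (Kinetic.Sp d)) (m : MeasureTheory.Measure (Kinetic.Sp d))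
    [MeasureTheory.SigmaFinite m] (hΩm : Kinetic.IsPhaseSpace Ω m)
    (k : Kinetic.Sp d → Kinetic.Sp d → Kinetic.Sp d → ℝ)
    (H : Kinetic.L1out Ω m →L[ℂ] Kinetic.L1in Ω m)
    (hH : Kinetic.IsAdmissibleBoundaryOp Ω m k H)
    (lam : ℂ) (hlam : lam ≠ 0) (hre : 0 ≤ lam.re) :
    Kinetic.IsTransferOp Ω m lam (Kinetic.transferOp Ω m lam) ∧
      spectralRadius ℂ (Kinetic.MH Ω m H lam) < 1 :=
  ⟨Kinetic.isTransferOp_transferOp hΩm hre, Kinetic.spectralRadius_MH_lt_one hΩm hH hlam hre⟩
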